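/- Candidates and voters live on the unit interval $[0,1]$. If $k\ge 1$ candidates stand at $x_1,\dots,x_k\in[0,1]$ and voters are uniformly distributed, the vote share of candidate $i$ is the Lebesgue measure of the set of $t\in[0,1]$ that are strictly closer to $x_i$ than to every other candidate; a candidate with maximal vote share is a plurality winner. For each $k\ge 1$ let the positions of the $k$ candidates be independent and uniformly distributed on $[0,1]$, let $P_k$ be the position of the plurality winner (a random variable; ties, if any, may be broken arbitrarily), and let $V_k$ be the winning (that is, the maximal) vote share. (No probabilistic moderation for uniform plurality.) As $k\to\infty$, $P_k$ converges in distribution to $\mathrm{Uniform}(0,1)$; that is, $\lim_{k\to\infty}\Pr(P_k\le x)=x$ for all $x\in[0,1]$. Moreover, with $n=k+1$, for every $x\in\mathbb{R}$, $$\lim_{k\to\infty}\Pr\left(V_k\le\frac{\log n+\log\log n+x}{2n}\right)=e^{-e^{-x}}.$$ -/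

import Mathlib

open MeasureTheory ProbabilityTheory Filter Set Topology

/-- The uniform distribution on the unit interval. It is the law of each candidate's position and
the distribution of the continuum of voters. -/
noncomputable def unitUniform : Measure ℝ := volume.restrict (Icc 0 1)

instance instIsProbabilityMeasureUnitUniform : IsProbabilityMeasure unitUniform :=
  ⟨by simp [unitUniform]⟩

/-- The set of positions of the voters who vote for candidate `i` when the candidates stand at
`x 0, …, x (k - 1)`: those strictly closer to `x i` than to any other candidate. -/
def votersFor {k : ℕ} (x : Fin k → ℝ) (i : Fin k) : Set ℝ :=
  {t | ∀ j, j ≠ i → |t - x i| < |t - x j|}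

/-- The vote share of candidate `i` with uniform voters. -/
noncomputable def voteShare {k : ℕ} (x : Fin k → ℝ) (i : Fin k) : ℝ :=
  unitUniform.real (votersFor x i)

/-- Candidate `i` is a plurality winner: no candidate has a larger vote share. -/
def IsPluralityWinner {k : ℕ} (x : Fin k → ℝ) (i : Fin k) : Prop :=
  ∀ j, voteShare x j ≤ voteShare x i

/-- The winning plurality vote share, i.e. the maximum of the candidates' vote shares. -/
noncomputable def winningShare {k : ℕ} (x : Fin k → ℝ) : ℝ :=
  ⨆ i, voteShare x i

open scoped ENNReal

/-! ### Spacings of uniform points and exponential random variables -/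

/-! Put `n = k + 1`. The spacings of `k` ordered uniform points are distributed as `e 0, …, e k`
divided by their sum `T`, for independent standard exponentials `e i`. Both statements concern
events that ignore the labels of the candidates, so they can be computed in the single space
`expSeq` (`expSeq_normalizedSums`). There the `i`-th candidate from the left gets `(e i + e (i + 1))
/ (2 T)`, except that an outermost candidate gets the whole outer spacing
(`voteShare_normalizedSums`).

Winning share: a pair sum exceeds `s` with probability `p = (1 + s) exp (-s)`, and two overlapping
pair sums both do so with probability at most `2 exp (-s)`, which is smaller by a factor of order
`s`. Exceedances therefore do not cluster, and a recursion over the number `m` of pair sums gives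
probability about `(1 - p) ^ m` that none exceeds `s` (`abs_expSeq_pairSumsLE_sub_le`). At `s = log
n + log log n + x` one has `k p → exp (-x)`, whence the Gumbel limit. Chebyshev's inequality
replaces `T` by `n`, and the outermost cells are too small to matter.

Position: close the spacings into a cycle. Rotation preserves the exponential law, so each of the
`n` indices is equally likely to carry the largest cyclic pair sum, and ties are null
(`expSeq_real_isCyclicMax_le`). With high probability every winner carries it
(`isCyclicMax_of_isPluralityWinner`), and concentration of partial sums turns a uniform index into a
uniform position. -/

lemma lintegral_pi_prod_eq_prod {n : ℕ} (μ : Fin n → Measure ℝ) [∀ i, SigmaFinite (μ i)]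
    (f : Fin n → ℝ → ℝ≥0∞) (hf : ∀ i, Measurable (f i)) :
    ∫⁻ x, ∏ i, f i (x i) ∂Measure.pi μ = ∏ i, ∫⁻ t, f i t ∂μ i := by
  induction n with
  | zero => simp
  | succ n ih =>
    have h := (measurePreserving_piFinSuccAbove μ 0).symm
    rw [← h.lintegral_comp (by fun_prop)]
    simp only [Fin.prod_univ_succ, MeasurableEquiv.piFinSuccAbove, Fin.insertNthEquiv_zero,
      MeasurableEquiv.symm_mk, MeasurableEquiv.coe_mk, Equiv.symm_symm, Fin.consEquiv_apply,
      Fin.cons_zero, Fin.cons_succ, Fin.succAbove_zero]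
    rw [← ih (fun i => μ i.succ) (fun i => f i.succ) (fun i => hf _),
      ← lintegral_prod_mul (hf 0).aemeasurable (Finset.measurable_prod _ fun i _ =>
        (hf i.succ).comp (measurable_pi_apply i)).aemeasurable]

lemma pi_withDensity {n : ℕ} (μ : Measure ℝ) [SigmaFinite μ] (f : ℝ → ℝ≥0∞) (hf : Measurable f)
    [SigmaFinite (μ.withDensity f)] :
    Measure.pi (fun _ : Fin n => μ.withDensity f)
      = (Measure.pi fun _ : Fin n => μ).withDensity fun x => ∏ i, f (x i) := by
  refine Measure.pi_eq fun s hs => ?_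
  rw [withDensity_apply _ (MeasurableSet.univ_pi hs), ← lintegral_indicator (MeasurableSet.univ_pi hs)]
  simp_rw [withDensity_apply _ (hs _), ← lintegral_indicator (hs _)]
  rw [← lintegral_pi_prod_eq_prod _ (fun i => (s i).indicator f) (fun i => hf.indicator (hs i))]
  refine lintegral_congr fun x => ?_
  by_cases hx : x ∈ univ.pi s
  · rw [indicator_of_mem hx]
    exact Finset.prod_congr rfl fun i _ => (indicator_of_mem (hx i trivial) _).symm
  · rw [indicator_of_notMem hx]
    simp only [mem_univ_pi, not_forall] at hx
    obtain ⟨i, hi⟩ := hx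
    exact (Finset.prod_eq_zero (Finset.mem_univ i) (indicator_of_notMem hi _)).symm

/-- Strictly increasing vectors with entries in `(0, 1)`. -/
def orderedSimplex (k : ℕ) : Set (Fin k → ℝ) := {x | StrictMono x ∧ ∀ i, x i ∈ Ioo (0 : ℝ) 1}

lemma measurableSet_orderedSimplex (k : ℕ) : MeasurableSet (orderedSimplex k) := by
  have : orderedSimplex k =
      (⋂ i, ⋂ j, ⋂ (_ : i < j), {x | x i < x j}) ∩ ⋂ i, {x | x i ∈ Ioo (0 : ℝ) 1} := by
    ext x; simp [orderedSimplex, StrictMono]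
  rw [this]
  refine .inter (.iInter fun i => .iInter fun j => .iInter fun _ =>
    measurableSet_lt (measurable_pi_apply i) (measurable_pi_apply j)) (.iInter fun i =>
      measurable_pi_apply i measurableSet_Ioo)

/-- Exactly one permutation sorts distinct numbers. -/
lemma sum_indicator_orderedSimplex {k : ℕ} {x : Fin k → ℝ} (hx : Function.Injective x)
    (h01 : ∀ i, x i ∈ Ioo (0 : ℝ) 1) :
    ∑ σ : Equiv.Perm (Fin k), (orderedSimplex k).indicator (1 : (Fin k → ℝ) → ℝ≥0∞) (x ∘ σ) = 1 := by
  rw [Finset.sum_eq_single (Tuple.sort x)]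
  · refine indicator_of_mem (show x ∘ _ ∈ orderedSimplex k from ⟨?_, fun i => h01 _⟩) _
    exact (Tuple.monotone_sort x).strictMono_of_injective (hx.comp (Equiv.injective _))
  · intro σ _ hσ
    refine indicator_of_notMem (fun h => hσ ?_) _
    have := Tuple.unique_monotone h.1.monotone (Tuple.monotone_sort x)
    ext i
    exact congrArg _ (hx (congrFun this i))
  · simp

lemma volume_setOf_dotProduct_eq_zero {n : ℕ} {c : Fin n → ℝ} (hc : c ≠ 0) :
    volume {x : Fin n → ℝ | c ⬝ᵥ x = 0} = 0 := by
  let L : (Fin n → ℝ) →ₗ[ℝ] ℝ :=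
    { toFun := fun x => c ⬝ᵥ x
      map_add' := fun x y => dotProduct_add c x y
      map_smul' := fun a x => dotProduct_smul a c x }
  refine Measure.addHaar_submodule volume (LinearMap.ker L) fun h => hc ?_
  have h0 := LinearMap.ker_eq_top.1 h
  ext i
  simpa [L] using LinearMap.congr_fun h0 (Pi.single i 1)

lemma volume_setOf_apply_eq {k : ℕ} {i j : Fin k} (hij : i ≠ j) :
    volume {x : Fin k → ℝ | x i = x j} = 0 := by
  have hc : (Pi.single i 1 - Pi.single j 1 : Fin k → ℝ) ≠ 0 := fun h => by
    simpa [hij] using congrFun h i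
  simpa [sub_dotProduct, sub_eq_zero] using volume_setOf_dotProduct_eq_zero hc

lemma pi_unitUniform (k : ℕ) :
    Measure.pi (fun _ : Fin k => unitUniform) = volume.restrict (univ.pi fun _ => Icc 0 1) := by
  simp only [unitUniform]
  rw [← Measure.restrict_pi_pi]; rfl

lemma ae_pi_unitUniform (k : ℕ) : ∀ᵐ x ∂Measure.pi (fun _ : Fin k => unitUniform),
    Function.Injective x ∧ ∀ i, x i ∈ Ioo (0 : ℝ) 1 := by
  have h1 : ∀ᵐ x ∂Measure.pi (fun _ : Fin k => unitUniform), ∀ i j, i ≠ j → x i ≠ x j := by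
    simp_rw [ae_all_iff]
    intro i j hij
    rw [pi_unitUniform]
    refine ae_restrict_of_ae ?_
    rw [ae_iff]
    simpa using volume_setOf_apply_eq hij
  have h2 : ∀ᵐ x ∂Measure.pi (fun _ : Fin k => unitUniform), ∀ i, x i ∈ Ioo (0 : ℝ) 1 := by
    rw [ae_all_iff]
    intro i
    refine (Measure.quasiMeasurePreserving_eval (μ := fun _ : Fin k => unitUniform) i).ae ?_
    rw [unitUniform, ← restrict_Ioo_eq_restrict_Icc]
    exact ae_restrict_mem measurableSet_Ioo
  filter_upwards [h1, h2] with x hx1 hx2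
  exact ⟨fun i j h => by_contra fun hij => hx1 i j hij h, hx2⟩

lemma lintegral_pi_unitUniform_comp_perm {k : ℕ} (σ : Equiv.Perm (Fin k)) (g : (Fin k → ℝ) → ℝ≥0∞)
    (hg : Measurable g) :
    ∫⁻ x, g (x ∘ σ) ∂Measure.pi (fun _ : Fin k => unitUniform)
      = ∫⁻ x, g x ∂Measure.pi (fun _ : Fin k => unitUniform) := by
  have h := measurePreserving_piCongrLeft (fun _ : Fin k => unitUniform) σ.symm
  rw [← h.lintegral_comp hg]
  refine lintegral_congr fun x => congrArg g (funext fun i => ?_)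
  have := Equiv.piCongrLeft_apply_apply (fun _ => ℝ) σ.symm x (σ i)
  simpa [MeasurableEquiv.coe_piCongrLeft] using this.symm

/-- Up to a null set the cube is the disjoint union of `k!` permuted copies of the ordered simplex,
and a symmetric function has the same integral over each. -/
lemma lintegral_pi_unitUniform_of_symm {k : ℕ} (g : (Fin k → ℝ) → ℝ≥0∞) (hg : Measurable g)
    (hsymm : ∀ (σ : Equiv.Perm (Fin k)) x, g (x ∘ σ) = g x) :
    ∫⁻ x, g x ∂Measure.pi (fun _ : Fin k => unitUniform)
      = k.factorial * ∫⁻ x in orderedSimplex k, g x := by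
  have hm := measurableSet_orderedSimplex k
  have hmeas : Measurable ((orderedSimplex k).indicator (1 : (Fin k → ℝ) → ℝ≥0∞)) :=
    measurable_one.indicator hm
  have hcomp (σ : Equiv.Perm (Fin k)) : Measurable fun x : Fin k → ℝ => x ∘ σ :=
    measurable_pi_iff.2 fun i => measurable_pi_apply _
  calc ∫⁻ x, g x ∂Measure.pi (fun _ : Fin k => unitUniform)
      = ∫⁻ x, ∑ σ : Equiv.Perm (Fin k), (orderedSimplex k).indicator 1 (x ∘ σ) * g (x ∘ σ)
          ∂Measure.pi (fun _ : Fin k => unitUniform) := by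
        refine lintegral_congr_ae ?_
        filter_upwards [ae_pi_unitUniform k] with x hx
        simp_rw [hsymm, ← Finset.sum_mul, sum_indicator_orderedSimplex hx.1 hx.2, one_mul]
    _ = ∑ σ : Equiv.Perm (Fin k), ∫⁻ x, (orderedSimplex k).indicator 1 (x ∘ σ) * g (x ∘ σ)
          ∂Measure.pi (fun _ : Fin k => unitUniform) :=
        lintegral_finsetSum _ fun σ _ => (hmeas.comp (hcomp σ)).mul (hg.comp (hcomp σ))
    _ = ∑ _σ : Equiv.Perm (Fin k), ∫⁻ x in orderedSimplex k, g x := by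
        refine Finset.sum_congr rfl fun σ _ => ?_
        rw [lintegral_pi_unitUniform_comp_perm σ (fun x => (orderedSimplex k).indicator 1 x * g x)
          (hmeas.mul hg), pi_unitUniform, ← lintegral_indicator hm,
          ← lintegral_indicator (.univ_pi fun _ => measurableSet_Icc)]
        refine lintegral_congr fun x => ?_
        by_cases hx : x ∈ orderedSimplex k
        · rw [indicator_of_mem (show x ∈ univ.pi fun _ => Icc (0 : ℝ) 1 from
            fun i _ => Ioo_subset_Icc_self (hx.2 i))]
          simp [hx]
        · simp [hx]
    _ = k.factorial * ∫⁻ x in orderedSimplex k, g x := by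
        simp [Fintype.card_perm]

/-- Extension of a finite sequence by zero. -/
def extendZero {n : ℕ} (y : Fin n → ℝ) (i : ℕ) : ℝ := if h : i < n then y ⟨i, h⟩ else 0

/-- The points cut out by the normalized partial sums of `e 0, …, e k`. -/
noncomputable def normalizedSums (k : ℕ) (e : ℕ → ℝ) (i : Fin k) : ℝ :=
  (∑ j ∈ Finset.range (i + 1), e j) / ∑ j ∈ Finset.range (k + 1), e j

lemma normalizedSums_congr {k : ℕ} {e e' : ℕ → ℝ} (h : ∀ i ≤ k, e i = e' i) :
    normalizedSums k e = normalizedSums k e' := by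
  ext i
  simp only [normalizedSums]
  congr 1
  · exact Finset.sum_congr rfl fun j hj => h j (by have := Finset.mem_range.1 hj; omega)
  · exact Finset.sum_congr rfl fun j hj => h j (by have := Finset.mem_range.1 hj; omega)

/-- The linear map of partial sums. -/
def partialSums (n : ℕ) : (Fin n → ℝ) →ₗ[ℝ] (Fin n → ℝ) where
  toFun y i := ∑ j ∈ Finset.range (i + 1), extendZero y j
  map_add' x y := by
    ext i
    simp only [Pi.add_apply, ← Finset.sum_add_distrib]
    refine Finset.sum_congr rfl fun j _ => ?_
    simp only [extendZero]; split_ifs <;> simp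
  map_smul' c y := by
    ext i
    simp only [Pi.smul_apply, smul_eq_mul, Finset.mul_sum, RingHom.id_apply]
    refine Finset.sum_congr rfl fun j _ => ?_
    simp only [extendZero]; split_ifs <;> simp

lemma partialSums_apply {n : ℕ} (y : Fin n → ℝ) (i : Fin n) :
    partialSums n y i = ∑ j ∈ Finset.range (i + 1), extendZero y j := rfl

/-- Consecutive partial sums determine each term. The value of the determinant is not needed,
because the constant in `exists_lintegral_normalizedSums_eq` absorbs it. -/
lemma det_partialSums_ne_zero (n : ℕ) : LinearMap.det (partialSums n) ≠ 0 := by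
  have hinj : Function.Injective (partialSums n) := by
    rw [← LinearMap.ker_eq_bot, LinearMap.ker_eq_bot']
    intro y hy
    have key : ∀ m ≤ n, ∑ j ∈ Finset.range m, extendZero y j = 0 := by
      rintro (_ | m) hm
      · simp
      · exact congrFun hy ⟨m, hm⟩
    ext i
    have h1 := key (i + 1) i.2
    rw [Finset.sum_range_succ, key i i.2.le] at h1
    simpa [extendZero] using h1
  exact (LinearEquiv.isUnit_det' (LinearEquiv.ofInjectiveEndo _ hinj)).ne_zero

/-- The sign of the total must be imposed separately: normalization does not distinguish `e` from
`-e`. -/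
lemma mem_orderedSimplex_normalizedSums_iff {k : ℕ} (e : ℕ → ℝ) :
    (0 < ∑ j ∈ Finset.range (k + 1), e j ∧ normalizedSums k e ∈ orderedSimplex k)
      ↔ ∀ i ≤ k, 0 < e i := by
  constructor
  · rintro ⟨hT, hmono, h01⟩ i hi
    have hpos : ∀ m ≤ k, 0 < ∑ j ∈ Finset.range (m + 1), e j := fun m hm => by
      rcases hm.lt_or_eq with hm | rfl
      · have := (h01 ⟨m, hm⟩).1
        simp only [normalizedSums] at this
        exact (div_pos_iff_of_pos_right hT).1 this
      · exact hT
    rcases i with _ | i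
    · simpa using hpos 0 hi
    · have hlt : ∑ j ∈ Finset.range (i + 1), e j < ∑ j ∈ Finset.range (i + 1 + 1), e j := by
        rcases hi.lt_or_eq with hi | rfl
        · have := hmono (show (⟨i, by omega⟩ : Fin k) < ⟨i + 1, hi⟩ by simp)
          simp only [normalizedSums] at this
          exact (div_lt_div_iff_of_pos_right hT).1 this
        · have := (h01 ⟨i, by omega⟩).2
          simp only [normalizedSums] at this
          exact (div_lt_one hT).1 this
      rw [Finset.sum_range_succ _ (i + 1)] at hlt
      linarith
  · intro h
    have hlt : ∀ a b, a < b → b ≤ k + 1 →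
        ∑ j ∈ Finset.range a, e j < ∑ j ∈ Finset.range b, e j := fun a b hab hb =>
      Finset.sum_lt_sum_of_subset (Finset.range_mono hab.le) (i := a) (by simpa) (by simp)
        (h a (by omega)) fun j hj _ => (h j (by have := Finset.mem_range.1 hj; omega)).le
    have hT : 0 < ∑ j ∈ Finset.range (k + 1), e j := by simpa using hlt 0 (k + 1) (by omega) le_rfl
    refine ⟨hT, fun a b hab => ?_, fun i => ⟨?_, ?_⟩⟩
    · exact (div_lt_div_iff_of_pos_right hT).2 (hlt _ _ (by simpa using hab) (by omega))
    · exact div_pos (by simpa using hlt 0 (i + 1) (by omega) (by omega)) hT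
    · exact (div_lt_one hT).2 (hlt _ _ (by omega) le_rfl)

lemma measurable_extendZero {n : ℕ} (i : ℕ) : Measurable fun y : Fin n → ℝ => extendZero y i := by
  unfold extendZero
  split_ifs
  · exact measurable_pi_apply _
  · exact measurable_const

lemma measurable_normalizedSums (k : ℕ) : Measurable (normalizedSums k) := by
  unfold normalizedSums
  fun_prop

instance instIsProbabilityMeasureExpMeasureOne : IsProbabilityMeasure (expMeasure 1) :=
  isProbabilityMeasure_expMeasure one_pos

lemma expMeasure_eq_withDensity : expMeasure 1 = volume.withDensity (exponentialPDF 1) := rfl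

lemma measurable_exponentialPDF : Measurable (exponentialPDF 1) :=
  (measurable_exponentialPDFReal 1).ennreal_ofReal

lemma pi_expMeasure (n : ℕ) : Measure.pi (fun _ : Fin n => expMeasure 1)
    = (volume : Measure (Fin n → ℝ)).withDensity fun x => ∏ i, exponentialPDF 1 (x i) := by
  have h : SigmaFinite (volume.withDensity (exponentialPDF 1)) :=
    inferInstanceAs (SigmaFinite (expMeasure 1))
  exact pi_withDensity volume (exponentialPDF 1) measurable_exponentialPDF

/-- The joint density depends only on the total `τ`, which is what separates `τ` from the normalized
points. Zero coordinates are excluded because the density does not vanish at `0`, while the ordered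
simplex is strict. -/
lemma prod_exponentialPDF_mul_eq {k : ℕ} (g : (Fin k → ℝ) → ℝ≥0∞) {y : Fin (k + 1) → ℝ}
    (hy : ∀ i, y i ≠ 0) :
    (∏ i, exponentialPDF 1 (y i)) * g (normalizedSums k (extendZero y))
      = (Ioi 0).indicator (fun τ => ENNReal.ofReal (Real.exp (-τ)))
          (partialSums (k + 1) y (Fin.last k)) * (orderedSimplex k).indicator g
          ((partialSums (k + 1) y (Fin.last k))⁻¹ •
            fun i : Fin k => partialSums (k + 1) y i.castSucc) := by
  have hT : partialSums (k + 1) y (Fin.last k) = ∑ j ∈ Finset.range (k + 1), extendZero y j := rfl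
  have hx : (partialSums (k + 1) y (Fin.last k))⁻¹ •
      (fun i : Fin k => partialSums (k + 1) y i.castSucc) = normalizedSums k (extendZero y) := by
    ext i
    simp [partialSums_apply, normalizedSums, div_eq_inv_mul]
  have hext (i : Fin (k + 1)) : extendZero y i = y i := dif_pos i.2
  have hiff := mem_orderedSimplex_normalizedSums_iff (k := k) (extendZero y)
  rw [hx, hT]
  by_cases hpos : ∀ i, 0 < y i
  · obtain ⟨h1, h2⟩ := hiff.2 fun i hi => by
      have := hpos ⟨i, by omega⟩
      rwa [← hext] at this
    rw [indicator_of_mem (show _ ∈ Ioi (0 : ℝ) from h1), indicator_of_mem h2]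
    congr 1
    simp_rw [fun i => exponentialPDF_of_nonneg (r := 1) (hpos i).le, one_mul]
    rw [← ENNReal.ofReal_prod_of_nonneg fun i _ => (Real.exp_pos _).le, ← Real.exp_sum,
      Finset.sum_range, Finset.sum_neg_distrib]
    simp [hext]
  · have hnot : ¬ ((∑ j ∈ Finset.range (k + 1), extendZero y j) ∈ Ioi (0 : ℝ) ∧
        normalizedSums k (extendZero y) ∈ orderedSimplex k) := fun h =>
      hpos fun i => hext i ▸ hiff.1 h i (by omega)
    push Not at hpos
    obtain ⟨i, hi⟩ := hpos
    rw [Finset.prod_eq_zero (Finset.mem_univ i)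
      (exponentialPDF_of_neg (lt_of_le_of_ne hi (hy i))), zero_mul]
    rw [not_and_or] at hnot
    rcases hnot with h | h
    · rw [indicator_of_notMem h, zero_mul]
    · rw [indicator_of_notMem h, mul_zero]

lemma lintegral_inv_smul {k : ℕ} (G : (Fin k → ℝ) → ℝ≥0∞) (hG : Measurable G) {τ : ℝ}
    (hτ : 0 < τ) : ∫⁻ t, G (τ⁻¹ • t) = ENNReal.ofReal (τ ^ k) * ∫⁻ t, G t := by
  have h := Measure.map_addHaar_smul (volume : Measure (Fin k → ℝ)) (inv_ne_zero hτ.ne')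
  rw [← lintegral_map hG (measurable_const_smul _), h, lintegral_smul_measure]
  congr 2
  simp [abs_of_pos (pow_pos hτ k)]

/-- Change variables to partial sums, then scale the first `k` of them by the last one, `τ`. The
integrand splits into a function of `τ` times a function of the normalized points, so these are
uniform on the ordered simplex. -/
lemma exists_lintegral_normalizedSums_eq (k : ℕ) : ∃ C : ℝ≥0∞, ∀ g : (Fin k → ℝ) → ℝ≥0∞,
    Measurable g →
    ∫⁻ y, g (normalizedSums k (extendZero y)) ∂Measure.pi (fun _ : Fin (k + 1) => expMeasure 1)
      = C * ∫⁻ x in orderedSimplex k, g x := by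
  set h : ℝ → ℝ≥0∞ := (Ioi 0).indicator fun τ => ENNReal.ofReal (Real.exp (-τ)) with hh
  have hmeas : Measurable h := Measurable.indicator (by fun_prop) measurableSet_Ioi
  refine ⟨ENNReal.ofReal |(LinearMap.det (partialSums (k + 1)))⁻¹| *
    ∫⁻ τ, h τ * ENNReal.ofReal (τ ^ k), fun g hg => ?_⟩
  set G := (orderedSimplex k).indicator g with hGdef
  have hG : Measurable G := hg.indicator (measurableSet_orderedSimplex k)
  set F : (Fin (k + 1) → ℝ) → ℝ≥0∞ := fun t =>
    h (t (Fin.last k)) * G ((t (Fin.last k))⁻¹ • fun i : Fin k => t i.castSucc) with hFdef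
  have hF : Measurable F := by
    refine (hmeas.comp (measurable_pi_apply _)).mul (hG.comp ?_)
    exact measurable_pi_iff.2 fun i =>
      (measurable_pi_apply (Fin.last k)).inv.mul (measurable_pi_apply i.castSucc)
  have hext : Measurable fun y : Fin (k + 1) → ℝ => g (normalizedSums k (extendZero y)) :=
    hg.comp ((measurable_normalizedSums k).comp (measurable_pi_iff.2 measurable_extendZero))
  have hdens : Measurable fun x : Fin (k + 1) → ℝ => ∏ i, exponentialPDF 1 (x i) :=
    Finset.measurable_prod _ fun i _ => measurable_exponentialPDF.comp (measurable_pi_apply i)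
  rw [pi_expMeasure, lintegral_withDensity_eq_lintegral_mul _ hdens hext]
  calc ∫⁻ y : Fin (k + 1) → ℝ, (∏ i, exponentialPDF 1 (y i)) * g (normalizedSums k (extendZero y))
      = ∫⁻ y, F (partialSums (k + 1) y) := by
        refine lintegral_congr_ae ?_
        have : ∀ᵐ y : Fin (k + 1) → ℝ, ∀ i, y i ≠ 0 :=
          ae_all_iff.2 fun i => Measure.ae_eval_ne (μ := fun _ : Fin (k + 1) => volume) i 0
        filter_upwards [this] with y hy
        exact prod_exponentialPDF_mul_eq g hy
    _ = ENNReal.ofReal |(LinearMap.det (partialSums (k + 1)))⁻¹| * ∫⁻ t, F t := by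
        rw [← lintegral_map hF (LinearMap.continuous_of_finiteDimensional _).measurable,
          Real.map_linearMap_volume_pi_eq_smul_volume_pi (det_partialSums_ne_zero _),
          lintegral_smul_measure, smul_eq_mul]
    _ = ENNReal.ofReal |(LinearMap.det (partialSums (k + 1)))⁻¹| *
          ((∫⁻ τ, h τ * ENNReal.ofReal (τ ^ k)) * ∫⁻ t, G t) := by
        congr 1
        rw [← ((volume_preserving_piFinSuccAbove (fun _ => ℝ) (Fin.last k)).symm).lintegral_comp hF]
        rw [Measure.volume_eq_prod, lintegral_prod _ (by fun_prop),
          ← lintegral_mul_const _ (by fun_prop)]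
        refine lintegral_congr fun τ => ?_
        simp only [hFdef, MeasurableEquiv.piFinSuccAbove, Fin.insertNthEquiv_last,
          MeasurableEquiv.symm_mk, MeasurableEquiv.coe_mk, Equiv.symm_symm, Fin.snocEquiv_apply,
          Fin.snoc_last, Fin.snoc_castSucc]
        by_cases hτ : 0 < τ
        · rw [lintegral_const_mul _ (by fun_prop), mul_assoc, ← lintegral_inv_smul G hG hτ]
        · simp [hh, hτ]
    _ = _ := by
        rw [mul_assoc, hGdef, lintegral_indicator (measurableSet_orderedSimplex k)]

theorem pi_expMeasure_normalizedSums {k : ℕ} {B : Set (Fin k → ℝ)} (hB : MeasurableSet B)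
    (hsymm : ∀ (σ : Equiv.Perm (Fin k)) x, x ∘ σ ∈ B ↔ x ∈ B) :
    Measure.pi (fun _ : Fin (k + 1) => expMeasure 1) {y | normalizedSums k (extendZero y) ∈ B}
      = Measure.pi (fun _ : Fin k => unitUniform) B := by
  obtain ⟨C, hC⟩ := exists_lintegral_normalizedSums_eq k
  have hms := measurableSet_orderedSimplex k
  have h1 := hC 1 measurable_one
  have h2 := lintegral_pi_unitUniform_of_symm (k := k) 1 measurable_one fun _ _ => rfl
  simp only [Pi.one_apply, lintegral_one, measure_univ, Measure.restrict_apply_univ] at h1 h2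
  -- Both sides have total mass one, so testing against `1` makes `C` and `k!` inverse to the volume
  -- of the same simplex.
  have hCk : C = k.factorial := by
    rw [ENNReal.eq_inv_of_mul_eq_one_left h1.symm, ENNReal.eq_inv_of_mul_eq_one_left h2.symm]
  have h3 := hC (B.indicator 1) (measurable_one.indicator hB)
  have h4 := lintegral_pi_unitUniform_of_symm (k := k) (B.indicator 1)
    (measurable_one.indicator hB) fun σ x => by
    by_cases hx : x ∈ B
    · rw [indicator_of_mem hx, indicator_of_mem ((hsymm σ x).2 hx)]; rfl
    · rw [indicator_of_notMem hx, indicator_of_notMem (hx ∘ (hsymm σ x).1)]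
  rw [hCk, ← h4, lintegral_indicator_one hB] at h3
  rw [← h3, ← lintegral_indicator_one]
  · rfl
  · exact ((measurable_normalizedSums k).comp (measurable_pi_iff.2 measurable_extendZero)) hB

/-- The law of an independent sequence of standard exponential random variables. -/
noncomputable def expSeq : Measure (ℕ → ℝ) := Measure.infinitePi fun _ => expMeasure 1

instance : IsProbabilityMeasure expSeq := by unfold expSeq; infer_instance

lemma measurePreserving_comp_of_injective {f : ℕ → ℕ} (hf : Function.Injective f) :
    MeasurePreserving (fun e : ℕ → ℝ => e ∘ f) expSeq expSeq :=
  ⟨measurable_pi_iff.2 fun _ => measurable_pi_apply _,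
    Measure.map_infinitePi_infinitePi_of_inj (P := fun _ => expMeasure 1) hf⟩

lemma measurePreserving_expSeq_fin (n : ℕ) : MeasurePreserving (fun (e : ℕ → ℝ) (i : Fin n) => e i)
    expSeq (Measure.pi fun _ : Fin n => expMeasure 1) := by
  refine ⟨measurable_pi_iff.2 fun i => measurable_pi_apply _, ?_⟩
  rw [← Measure.infinitePi_eq_pi]
  exact Measure.map_infinitePi_infinitePi_of_inj (P := fun _ => expMeasure 1) Fin.val_injective

theorem expSeq_normalizedSums {k : ℕ} {B : Set (Fin k → ℝ)} (hB : MeasurableSet B)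
    (hsymm : ∀ (σ : Equiv.Perm (Fin k)) x, x ∘ σ ∈ B ↔ x ∈ B) :
    expSeq {e | normalizedSums k e ∈ B} = Measure.pi (fun _ : Fin k => unitUniform) B := by
  have hB' : MeasurableSet {y : Fin (k + 1) → ℝ | normalizedSums k (extendZero y) ∈ B} :=
    ((measurable_normalizedSums k).comp (measurable_pi_iff.2 measurable_extendZero)) hB
  rw [← pi_expMeasure_normalizedSums hB hsymm,
    ← (measurePreserving_expSeq_fin (k + 1)).measure_preimage hB'.nullMeasurableSet]
  congr 1
  ext e
  simp only [mem_ofPred_eq, mem_preimage]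
  rw [normalizedSums_congr (e' := extendZero fun i : Fin (k + 1) => e i)]
  intro i hi
  simp [extendZero, Nat.lt_succ_of_le hi]

/-! ### Vote shares in terms of spacings -/

lemma votersFor_comp_perm {k : ℕ} (σ : Equiv.Perm (Fin k)) (x : Fin k → ℝ) (i : Fin k) :
    votersFor (x ∘ σ) i = votersFor x (σ i) := by
  ext t
  refine ⟨fun h j hj => ?_, fun h j hj => h (σ j) (σ.injective.ne hj)⟩
  have := h (σ.symm j) fun h => hj (by simp [← h])
  simpa using this

lemma voteShare_comp_perm {k : ℕ} (σ : Equiv.Perm (Fin k)) (x : Fin k → ℝ) (i : Fin k) :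
    voteShare (x ∘ σ) i = voteShare x (σ i) := by
  simp only [voteShare, votersFor_comp_perm]

lemma isPluralityWinner_comp_perm {k : ℕ} (σ : Equiv.Perm (Fin k)) (x : Fin k → ℝ) (i : Fin k) :
    IsPluralityWinner (x ∘ σ) i ↔ IsPluralityWinner x (σ i) := by
  simp only [IsPluralityWinner, voteShare_comp_perm]
  exact σ.forall_congr_left.trans (by simp)

lemma winningShare_comp_perm {k : ℕ} (σ : Equiv.Perm (Fin k)) (x : Fin k → ℝ) :
    winningShare (x ∘ σ) = winningShare x := by
  simp only [winningShare, voteShare_comp_perm]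
  exact σ.iSup_comp (g := fun i => voteShare x i)

lemma measurable_voteShare {k : ℕ} (i : Fin k) : Measurable fun x : Fin k → ℝ => voteShare x i := by
  have hs : MeasurableSet {p : (Fin k → ℝ) × ℝ | p.2 ∈ votersFor p.1 i} := by
    have : {p : (Fin k → ℝ) × ℝ | p.2 ∈ votersFor p.1 i} =
        ⋂ j, ⋂ (_ : j ≠ i), {p : (Fin k → ℝ) × ℝ | |p.2 - p.1 i| < |p.2 - p.1 j|} := by
      ext p; simp [votersFor]
    rw [this]
    have hm (j : Fin k) : Measurable fun p : (Fin k → ℝ) × ℝ => |p.2 - p.1 j| :=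
      (by fun_prop : Continuous fun p : (Fin k → ℝ) × ℝ => |p.2 - p.1 j|).measurable
    exact .iInter fun j => .iInter fun _ => measurableSet_lt (hm i) (hm j)
  exact (measurable_measure_prodMk_left hs).ennreal_toReal

lemma measurable_winningShare {k : ℕ} : Measurable fun x : Fin k → ℝ => winningShare x :=
  Measurable.iSup measurable_voteShare

lemma measurableSet_isPluralityWinner {k : ℕ} (i : Fin k) :
    MeasurableSet {x : Fin k → ℝ | IsPluralityWinner x i} := by
  have : {x : Fin k → ℝ | IsPluralityWinner x i} = ⋂ j, {x | voteShare x j ≤ voteShare x i} := by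
    ext x; simp [IsPluralityWinner]
  rw [this]
  exact .iInter fun j => measurableSet_le (measurable_voteShare j) (measurable_voteShare i)

/-- Endpoints have measure zero, so it does not matter how indifferent voters are counted. -/
lemma voteShare_eq_sub {k : ℕ} {x : Fin k → ℝ} {i : Fin k} {l r : ℝ} (h0 : 0 ≤ l) (hlr : l ≤ r)
    (h1 : r ≤ 1) (hsub : Ioo l r ⊆ votersFor x i) (hsup : votersFor x i ∩ Icc 0 1 ⊆ Icc l r) :
    voteShare x i = r - l := by
  have h : unitUniform (votersFor x i) = ENNReal.ofReal (r - l) := by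
    rw [unitUniform, Measure.restrict_apply' measurableSet_Icc]
    refine le_antisymm ((measure_mono hsup).trans_eq Real.volume_Icc) ?_
    rw [← Real.volume_Ioo]
    exact measure_mono fun t ht => ⟨hsub ht, h0.trans ht.1.le, ht.2.le.trans h1⟩
  rw [voteShare, measureReal_def, h, ENNReal.toReal_ofReal (sub_nonneg.2 hlr)]

lemma abs_sub_lt_abs_sub_iff_of_lt {a b t : ℝ} (h : a < b) : |t - a| < |t - b| ↔ t < (a + b) / 2 := by
  rw [← sq_lt_sq]
  constructor <;> intro h' <;> nlinarith

lemma abs_sub_lt_abs_sub_iff_of_gt {a b t : ℝ} (h : a < b) : |t - b| < |t - a| ↔ (a + b) / 2 < t := by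
  rw [← sq_lt_sq]
  constructor <;> intro h' <;> nlinarith

/-- The (unnormalized) double vote share of candidate `i` when the spacings are `e 0, …, e k`. -/
def cellLength (k : ℕ) (e : ℕ → ℝ) (i : ℕ) : ℝ :=
  e i + e (i + 1) + (if i = 0 then e 0 else 0) + (if i + 1 = k then e k else 0)

lemma voteShare_normalizedSums {k : ℕ} {e : ℕ → ℝ} (he : ∀ i ≤ k, 0 < e i) (i : Fin k) :
    voteShare (normalizedSums k e) i
      = cellLength k e i / (2 * ∑ j ∈ Finset.range (k + 1), e j) := by
  obtain ⟨hT, hmono, h01⟩ := (mem_orderedSimplex_normalizedSums_iff e).2 he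
  set T := ∑ j ∈ Finset.range (k + 1), e j with hTdef
  set x := normalizedSums k e with hx
  have hxi (j : Fin k) : x j = (∑ m ∈ Finset.range (j + 1), e m) / T := rfl
  -- The cell runs between the midpoints to the two neighbours, with `0` or `1` in place of a
  -- missing neighbour. By monotonicity no other candidate constrains it further.
  set l : ℝ := if i.1 = 0 then 0 else (∑ m ∈ Finset.range i, e m) / T / 2 + x i / 2 with hl
  set r : ℝ := if i.1 + 1 = k then 1 else x i / 2 + (∑ m ∈ Finset.range (i + 2), e m) / T / 2
    with hr
  have hprev (h : i.1 ≠ 0) : (∑ m ∈ Finset.range i, e m) / T = x ⟨i.1 - 1, by omega⟩ := by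
    simp only [hxi]
    rw [Nat.sub_add_cancel (by omega)]
  have hnext (h : i.1 + 1 ≠ k) :
      (∑ m ∈ Finset.range (i + 2), e m) / T = x ⟨i.1 + 1, by omega⟩ := rfl
  have hl0 : 0 ≤ l := by
    rw [hl]; split_ifs with h
    · exact le_rfl
    · rw [hprev h]; linarith [(h01 i).1, (h01 ⟨i.1 - 1, by omega⟩).1]
  have hli : l ≤ x i := by
    rw [hl]; split_ifs with h
    · exact (h01 i).1.le
    · rw [hprev h]
      have := hmono (show (⟨i.1 - 1, by omega⟩ : Fin k) < i from Fin.lt_def.2 (by simp; omega))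
      linarith
  have hir : x i ≤ r := by
    rw [hr]; split_ifs with h
    · exact (h01 i).2.le
    · rw [hnext h]
      have := hmono (show i < (⟨i.1 + 1, by omega⟩ : Fin k) from Fin.lt_def.2 (by simp))
      linarith
  have hr1 : r ≤ 1 := by
    rw [hr]; split_ifs with h
    · exact le_rfl
    · rw [hnext h]; linarith [(h01 i).2, (h01 ⟨i.1 + 1, by omega⟩).2]
  have hlj (j : Fin k) (hj : j < i) : (x j + x i) / 2 ≤ l := by
    have h : i.1 ≠ 0 := by have := Fin.lt_def.1 hj; omega
    rw [hl, if_neg h, hprev h]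
    have := hmono.monotone (show j ≤ (⟨i.1 - 1, by omega⟩ : Fin k) from
      Fin.le_def.2 (by have := Fin.lt_def.1 hj; simp; omega))
    linarith
  have hrj (j : Fin k) (hj : i < j) : r ≤ (x i + x j) / 2 := by
    have h : i.1 + 1 ≠ k := by have := Fin.lt_def.1 hj; omega
    rw [hr, if_neg h, hnext h]
    have := hmono.monotone (show (⟨i.1 + 1, by omega⟩ : Fin k) ≤ j from
      Fin.le_def.2 (by have := Fin.lt_def.1 hj; simp; omega))
    linarith
  rw [voteShare_eq_sub hl0 (hli.trans hir) hr1]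
  · have h2 : x i = (∑ m ∈ Finset.range i, e m) / T + e i / T := by
      rw [hxi, Finset.sum_range_succ, add_div]
    have h3 : (∑ m ∈ Finset.range (i + 2), e m) / T = x i + e (i + 1) / T := by
      rw [Finset.sum_range_succ, add_div, hxi]
    have h4 (h : i.1 + 1 = k) : 1 = x i + e k / T := by
      rw [hxi, h, ← add_div, ← Finset.sum_range_succ, div_self hT.ne']
    have h5 (h : i.1 = 0) : x i = e 0 / T := by simp [hxi, h]
    have h6 : cellLength k e i / (2 * T) = e i / T / 2 + e (i + 1) / T / 2 +
        (if i.1 = 0 then e 0 / T / 2 else 0) + (if i.1 + 1 = k then e k / T / 2 else 0) := by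
      rw [cellLength]; split_ifs <;> field_simp <;> ring
    rw [h6, hr, hl, h3]
    split_ifs with ha hb hb
    · rw [ha, hb]; linarith [h4 ha, h5 hb]
    · rw [ha]; linarith [h4 ha, h2]
    · rw [hb, zero_add]; linarith [h5 hb]
    · linarith [h2]
  · rintro t ⟨htl, htr⟩ j hj
    rcases lt_or_gt_of_ne hj with hj | hj
    · exact (abs_sub_lt_abs_sub_iff_of_gt (hmono hj)).2 ((hlj j hj).trans_lt htl)
    · exact (abs_sub_lt_abs_sub_iff_of_lt (hmono hj)).2 (htr.trans_le (hrj j hj))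
  · rintro t ⟨htv, ht0, ht1⟩
    constructor
    · rw [hl]; split_ifs with h
      · exact ht0
      · have hlt : (⟨i.1 - 1, by omega⟩ : Fin k) < i := Fin.lt_def.2 (by simp; omega)
        have := (abs_sub_lt_abs_sub_iff_of_gt (hmono hlt)).1 (htv _ hlt.ne)
        rw [hprev h]; linarith
    · rw [hr]; split_ifs with h
      · exact ht1
      · have hlt : i < (⟨i.1 + 1, by omega⟩ : Fin k) := Fin.lt_def.2 (by simp)
        have := (abs_sub_lt_abs_sub_iff_of_lt (hmono hlt)).1 (htv _ hlt.ne')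
        rw [hnext h]; linarith

/-! ### Independent exponential random variables -/

lemma expMeasure_eq_restrict_withDensity : expMeasure 1 =
    (volume.restrict (Ioi 0)).withDensity fun x => ENNReal.ofReal (Real.exp (-x)) := by
  rw [expMeasure_eq_withDensity, restrict_Ioi_eq_restrict_Ici,
    ← withDensity_indicator measurableSet_Ici]
  congr 1
  ext x
  by_cases hx : 0 ≤ x
  · simp [exponentialPDF_of_nonneg hx, hx]
  · simp [exponentialPDF_of_neg (not_le.1 hx), hx]

lemma lintegral_expMeasure {H : ℝ → ℝ≥0∞} (hH : Measurable H) :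
    ∫⁻ x, H x ∂expMeasure 1 = ∫⁻ x in Ioi 0, ENNReal.ofReal (Real.exp (-x)) * H x := by
  rw [expMeasure_eq_restrict_withDensity, lintegral_withDensity_eq_lintegral_mul _ (by fun_prop) hH]
  rfl

lemma integrable_pow_expMeasure (n : ℕ) : Integrable (fun x => x ^ n) (expMeasure 1) := by
  rw [expMeasure_eq_restrict_withDensity,
    integrable_withDensity_iff (by fun_prop) (ae_of_all _ fun _ => ENNReal.ofReal_lt_top)]
  have := Real.GammaIntegral_convergent (s := n + 1) (by positivity)
  refine this.congr (ae_of_all _ fun x => ?_)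
  simp [ENNReal.toReal_ofReal (Real.exp_pos _).le, mul_comm]

lemma integral_pow_expMeasure (n : ℕ) : ∫ x, x ^ n ∂expMeasure 1 = n.factorial := by
  rw [expMeasure_eq_restrict_withDensity, integral_withDensity_eq_integral_toReal_smul (by fun_prop)
    (ae_of_all _ fun _ => ENNReal.ofReal_lt_top), ← Real.Gamma_nat_eq_factorial,
    Real.Gamma_eq_integral (by positivity)]
  refine integral_congr_ae (ae_of_all _ fun x => ?_)
  simp [ENNReal.toReal_ofReal (Real.exp_pos _).le]

lemma memLp_id_expMeasure : MemLp id 2 (expMeasure 1) :=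
  (memLp_two_iff_integrable_sq (by fun_prop)).2 (integrable_pow_expMeasure 2)

lemma expMeasure_Ioi (s : ℝ) : expMeasure 1 (Ioi s) = ENNReal.ofReal (Real.exp (-max s 0)) := by
  have h : (expMeasure 1).real (Ioi s) = Real.exp (-max s 0) := by
    rw [← compl_Iic, probReal_compl_eq_one_sub measurableSet_Iic, ← cdf_eq_real,
      cdf_expMeasure_eq one_pos]
    split_ifs with hs
    · simp [hs]
    · simp [(not_le.1 hs).le]
  rw [← h, ofReal_measureReal]

lemma iIndepFun_expSeq : iIndepFun (fun (i : ℕ) (e : ℕ → ℝ) => e i) expSeq :=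
  iIndepFun_infinitePi (P := fun _ : ℕ => expMeasure 1) (X := fun _ x => x) fun _ => measurable_id

lemma measurePreserving_eval_expSeq (i : ℕ) :
    MeasurePreserving (fun e : ℕ → ℝ => e i) expSeq (expMeasure 1) :=
  measurePreserving_eval_infinitePi (fun _ : ℕ => expMeasure 1) i

lemma expSeq_real_lt {s : ℝ} (hs : 0 ≤ s) (i : ℕ) :
    expSeq.real {e | s < e i} = Real.exp (-s) := by
  have h := (measurePreserving_eval_expSeq i).measure_preimage
    (measurableSet_Ioi (a := s)).nullMeasurableSet
  rw [expMeasure_Ioi, max_eq_left hs] at h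
  rw [measureReal_def, ← ENNReal.toReal_ofReal (Real.exp_pos (-s)).le, ← h]
  rfl

lemma ae_expSeq_pos : ∀ᵐ e ∂expSeq, ∀ i, 0 < e i := by
  refine ae_all_iff.2 fun i => ?_
  refine (measurePreserving_eval_expSeq i).quasiMeasurePreserving.ae (p := fun x => 0 < x) ?_
  rw [expMeasure_eq_restrict_withDensity]
  exact (withDensity_absolutelyContinuous _ _).ae_le (ae_restrict_mem measurableSet_Ioi)

/-- Chebyshev's inequality for sums of exponential random variables. -/
lemma expSeq_real_le_abs_sum_sub (n : ℕ) {c : ℝ} (hc : 0 < c) :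
    expSeq.real {e | c ≤ |∑ i ∈ Finset.range n, e i - n|} ≤ n / c ^ 2 := by
  have hL (i : ℕ) : MemLp (fun e : ℕ → ℝ => e i) 2 expSeq :=
    memLp_id_expMeasure.comp_measurePreserving (measurePreserving_eval_expSeq i)
  have hmean (i : ℕ) : ∫ e, e i ∂expSeq = 1 := by
    have := integral_map (μ := expSeq) (φ := fun e : ℕ → ℝ => e i)
      (measurePreserving_eval_expSeq i).measurable.aemeasurable
      (f := fun x : ℝ => x) (by fun_prop)
    rw [← this, (measurePreserving_eval_expSeq i).map_eq]
    simpa using integral_pow_expMeasure 1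
  have hvar (i : ℕ) : variance (fun e : ℕ → ℝ => e i) expSeq = 1 := by
    have h := integral_map (μ := expSeq) (φ := fun e : ℕ → ℝ => e i)
      (measurePreserving_eval_expSeq i).measurable.aemeasurable
      (f := fun x : ℝ => x ^ 2) (by fun_prop)
    rw [(measurePreserving_eval_expSeq i).map_eq, integral_pow_expMeasure 2] at h
    rw [variance_eq_sub (hL i), hmean]
    simp only [Pi.pow_apply]
    rw [← h]; norm_num [Nat.factorial]
  set S : (ℕ → ℝ) → ℝ := ∑ i ∈ Finset.range n, fun e => e i with hS
  have hSL : MemLp S 2 expSeq := memLp_finsetSum' _ fun i _ => hL i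
  have hSm : ∫ e, S e ∂expSeq = n := by
    simp only [hS, Finset.sum_apply]
    rw [integral_finsetSum _ fun i _ => (hL i).integrable one_le_two]
    simp [hmean]
  have hSv : variance S expSeq = n := by
    rw [hS, IndepFun.variance_sum (fun i _ => hL i) fun i _ j _ hij => iIndepFun_expSeq.indepFun hij]
    simp [hvar]
  have := meas_ge_le_variance_div_sq hSL hc
  rw [hSm, hSv] at this
  rw [measureReal_def]
  refine ENNReal.toReal_le_of_le_ofReal (by positivity) ?_
  simpa [hS] using this

/-- Condition on `e i = u`. For `u ≤ s` the integrand is the constant `exp (-s)`, contributing `s *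
exp (-s)`; the range `u > s` contributes `exp (-s)`. -/
lemma expSeq_real_lt_add {s : ℝ} (hs : 0 ≤ s) {i j : ℕ} (hij : i ≠ j) :
    expSeq.real {e | s < e i + e j} = (1 + s) * Real.exp (-s) := by
  have hmap := Measure.infinitePi_map_eval_prod (P := fun _ : ℕ => expMeasure 1) hij
  have hset : MeasurableSet {p : ℝ × ℝ | s < p.1 + p.2} :=
    measurableSet_lt measurable_const (by fun_prop)
  have hm : Measurable fun e : ℕ → ℝ => (e i, e j) := by fun_prop
  have hkey : expSeq {e | s < e i + e j} = ENNReal.ofReal ((1 + s) * Real.exp (-s)) := by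
    have h1 : expSeq {e | s < e i + e j} = (expSeq.map fun e => (e i, e j)) {p | s < p.1 + p.2} := by
      rw [Measure.map_apply hm hset]; rfl
    rw [h1, expSeq, hmap, Measure.prod_apply hset]
    have h2 (u : ℝ) : expMeasure 1 (Prod.mk u ⁻¹' {p : ℝ × ℝ | s < p.1 + p.2})
        = ENNReal.ofReal (Real.exp (-max (s - u) 0)) := by
      rw [← expMeasure_Ioi]
      congr 1; ext v; simp [sub_lt_iff_lt_add']
    simp_rw [h2]
    rw [lintegral_expMeasure (by fun_prop), ← Ioc_union_Ioi_eq_Ioi hs,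
      lintegral_union measurableSet_Ioi Ioc_disjoint_Ioi_same]
    have h3 : ∫⁻ x in Ioc 0 s, ENNReal.ofReal (Real.exp (-x)) *
        ENNReal.ofReal (Real.exp (-max (s - x) 0)) = ENNReal.ofReal (s * Real.exp (-s)) := by
      rw [setLIntegral_congr_fun (g := fun _ => ENNReal.ofReal (Real.exp (-s))) measurableSet_Ioc]
      · rw [setLIntegral_const, Real.volume_Ioc, ← ENNReal.ofReal_mul (Real.exp_pos _).le]
        ring_nf
      · intro x hx
        simp only
        rw [← ENNReal.ofReal_mul (Real.exp_pos _).le, ← Real.exp_add, max_eq_left (by linarith [hx.2])]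
        ring_nf
    have h4 : ∫⁻ x in Ioi s, ENNReal.ofReal (Real.exp (-x)) *
        ENNReal.ofReal (Real.exp (-max (s - x) 0)) = ENNReal.ofReal (Real.exp (-s)) := by
      rw [setLIntegral_congr_fun (g := fun x => ENNReal.ofReal (Real.exp (-x))) measurableSet_Ioi]
      · rw [← ofReal_integral_eq_lintegral_ofReal (integrableOn_exp_neg_Ioi s)
          (ae_of_all _ fun x => (Real.exp_pos _).le), integral_exp_neg_Ioi]
      · intro x hx
        simp only
        rw [max_eq_right (by linarith [mem_Ioi.1 hx])]
        simp
    rw [h3, h4, ← ENNReal.ofReal_add (by positivity) (by positivity)]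
    ring_nf
  rw [measureReal_def, hkey, ENNReal.toReal_ofReal (by positivity)]

/-- Given the shared variable `e j = u`, the two events are independent with probability `exp (-max
(s - u) 0)` each. The ranges `u ≤ s` and `u > s` each contribute at most `exp (-s)`. The absence of
a factor `s` is what rules out clustering. -/
lemma expSeq_real_lt_add_and_lt_add_le {s : ℝ} (hs : 0 ≤ s) {i j l : ℕ} (hij : i ≠ j) (hjl : j ≠ l)
    (hil : i ≠ l) :
    expSeq.real {e | s < e i + e j ∧ s < e j + e l} ≤ 2 * Real.exp (-s) := by
  have hm : Measurable fun e : ℕ → ℝ => (e i, e l) := by fun_prop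
  have hmj : Measurable fun e : ℕ → ℝ => e j := by fun_prop
  have hmap : expSeq.map (fun e => (e j, (e i, e l)))
      = (expMeasure 1).prod ((expMeasure 1).prod (expMeasure 1)) := by
    have hI := (iIndepFun_expSeq.indepFun_prodMk (fun i => measurable_pi_apply i) i l j hij
      hjl.symm).symm
    rw [(indepFun_iff_map_prod_eq_prod_map_map hmj.aemeasurable hm.aemeasurable).1 hI,
      (measurePreserving_eval_expSeq j).map_eq]
    congr 1
    exact Measure.infinitePi_map_eval_prod (P := fun _ : ℕ => expMeasure 1) hil
  have hset : MeasurableSet {p : ℝ × (ℝ × ℝ) | s < p.2.1 + p.1 ∧ s < p.1 + p.2.2} :=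
    MeasurableSet.inter (s₁ := {p : ℝ × (ℝ × ℝ) | s < p.2.1 + p.1})
      (s₂ := {p : ℝ × (ℝ × ℝ) | s < p.1 + p.2.2}) (measurableSet_lt measurable_const (by fun_prop))
      (measurableSet_lt measurable_const (by fun_prop))
  have hkey : expSeq {e | s < e i + e j ∧ s < e j + e l} ≤ ENNReal.ofReal (2 * Real.exp (-s)) := by
    have h1 : expSeq {e | s < e i + e j ∧ s < e j + e l} = (expSeq.map fun e => (e j, (e i, e l)))
        {p | s < p.2.1 + p.1 ∧ s < p.1 + p.2.2} := by
      rw [Measure.map_apply (by fun_prop) hset]; rfl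
    rw [h1, hmap, Measure.prod_apply hset]
    have h2 (u : ℝ) : ((expMeasure 1).prod (expMeasure 1))
        (Prod.mk u ⁻¹' {p : ℝ × (ℝ × ℝ) | s < p.2.1 + p.1 ∧ s < p.1 + p.2.2})
        = ENNReal.ofReal (Real.exp (-max (s - u) 0)) * ENNReal.ofReal (Real.exp (-max (s - u) 0)) := by
      rw [← expMeasure_Ioi, ← Measure.prod_prod]
      congr 1; ext v; simp [sub_lt_iff_lt_add, add_comm]
    simp_rw [h2]
    rw [lintegral_expMeasure (by fun_prop), ← Ioc_union_Ioi_eq_Ioi hs,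
      lintegral_union measurableSet_Ioi Ioc_disjoint_Ioi_same]
    have h3 : ∫⁻ x in Ioc 0 s, ENNReal.ofReal (Real.exp (-x)) *
        (ENNReal.ofReal (Real.exp (-max (s - x) 0)) * ENNReal.ofReal (Real.exp (-max (s - x) 0)))
          ≤ ENNReal.ofReal (Real.exp (-s)) := by
      rw [setLIntegral_congr_fun
        (g := fun x => ENNReal.ofReal (Real.exp (-2 * s) * Real.exp x)) measurableSet_Ioc]
      · rw [← ofReal_integral_eq_lintegral_ofReal
          ((by fun_prop : Continuous fun x => Real.exp (-2 * s) * Real.exp x).integrableOn_Ioc)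
          (ae_of_all _ fun x => by positivity), ← intervalIntegral.integral_of_le hs,
          intervalIntegral.integral_const_mul, integral_exp]
        refine ENNReal.ofReal_le_ofReal ?_
        rw [mul_sub, ← Real.exp_add, Real.exp_zero]
        ring_nf
        linarith [Real.exp_pos (-(s * 2))]
      · intro x hx
        simp only
        rw [← ENNReal.ofReal_mul (Real.exp_pos _).le, ← ENNReal.ofReal_mul (Real.exp_pos _).le,
          ← Real.exp_add, ← Real.exp_add, ← Real.exp_add, max_eq_left (by linarith [hx.2])]
        ring_nf
    have h4 : ∫⁻ x in Ioi s, ENNReal.ofReal (Real.exp (-x)) *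
        (ENNReal.ofReal (Real.exp (-max (s - x) 0)) * ENNReal.ofReal (Real.exp (-max (s - x) 0)))
          = ENNReal.ofReal (Real.exp (-s)) := by
      rw [setLIntegral_congr_fun (g := fun x => ENNReal.ofReal (Real.exp (-x))) measurableSet_Ioi]
      · rw [← ofReal_integral_eq_lintegral_ofReal (integrableOn_exp_neg_Ioi s)
          (ae_of_all _ fun x => (Real.exp_pos _).le), integral_exp_neg_Ioi]
      · intro x hx
        simp only
        rw [max_eq_right (by linarith [mem_Ioi.1 hx])]
        simp
    rw [h4]
    refine (add_le_add_left h3 _).trans ?_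
    rw [← ENNReal.ofReal_add (by positivity) (by positivity), two_mul]
  exact ENNReal.toReal_le_of_le_ofReal (by positivity) hkey

/-! ### The maximum of sums of two consecutive exponential variables -/

lemma measureReal_le_of_ae_imp {Ω : Type*} [MeasurableSpace Ω] {μ : Measure Ω} [IsFiniteMeasure μ]
    {A B : Set Ω} (h : ∀ᵐ ω ∂μ, ω ∈ A → ω ∈ B) : μ.real A ≤ μ.real B :=
  ENNReal.toReal_mono (measure_ne_top _ _) (measure_mono_ae h)

lemma measureReal_le_add_of_ae_imp {Ω : Type*} [MeasurableSpace Ω] {μ : Measure Ω}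
    [IsFiniteMeasure μ] {A B C : Set Ω} (h : ∀ᵐ ω ∂μ, ω ∈ A → ω ∈ B ∨ ω ∈ C) :
    μ.real A ≤ μ.real B + μ.real C :=
  (measureReal_le_of_ae_imp (B := B ∪ C) h).trans (measureReal_union_le _ _)

/-- All the sums of two consecutive terms among `e 0, …, e m` are at most `s`. -/
def pairSumsLE (s : ℝ) (m : ℕ) : Set (ℕ → ℝ) := {e | ∀ j < m, e j + e (j + 1) ≤ s}

lemma pairSumsLE_succ (s : ℝ) (m : ℕ) :
    pairSumsLE s (m + 1) = pairSumsLE s m \ {e | s < e m + e (m + 1)} := by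
  ext e
  simp only [pairSumsLE, mem_ofPred_eq, Set.mem_sdiff, not_lt]
  exact Nat.forall_lt_succ_right

lemma measurableSet_lt_add (s : ℝ) (i j : ℕ) : MeasurableSet {e : ℕ → ℝ | s < e i + e j} :=
  measurableSet_lt measurable_const (by fun_prop)

/-- The first event involves only `e 0, …, e m`, so skipping the one pair that shares `e (m + 1)`
restores independence. -/
lemma expSeq_real_pairSumsLE_inter (s : ℝ) (m : ℕ) :
    expSeq.real (pairSumsLE s m ∩ {e | s < e (m + 1) + e (m + 2)})
      = expSeq.real (pairSumsLE s m) * expSeq.real {e | s < e (m + 1) + e (m + 2)} := by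
  have hI := iIndepFun_expSeq.indepFun_finset (Finset.range (m + 1)) {m + 1, m + 2}
    (by simp) (fun i => measurable_pi_apply i)
  set A : Set (Finset.range (m + 1) → ℝ) := {a | ∀ j, ∀ h : j < m,
    a ⟨j, Finset.mem_range.2 (by omega)⟩ + a ⟨j + 1, Finset.mem_range.2 (by omega)⟩ ≤ s} with hA
  set B : Set (({m + 1, m + 2} : Finset ℕ) → ℝ) :=
    {a | s < a ⟨m + 1, by simp⟩ + a ⟨m + 2, by simp⟩} with hB
  have hAm : MeasurableSet A := by
    simp only [hA, ofPred_forall]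
    exact .iInter fun j => .iInter fun h => measurableSet_le (by fun_prop) measurable_const
  have hBm : MeasurableSet B := measurableSet_lt measurable_const (by fun_prop)
  have := hI.measure_inter_preimage_eq_mul A B hAm hBm
  have h2 := congrArg ENNReal.toReal this
  rw [ENNReal.toReal_mul] at h2
  exact h2

/-- Replacing `p * q m` by `p * q (m + 1)` costs at most `p ^ 2`, since `q` drops by at most `p` per
step. Thus `q` is geometric with ratio `1 - p` up to `p ^ 2 + ε` per step, and as `0 ≤ 1 - p ≤ 1`
these errors merely add up. -/
lemma abs_sub_pow_le_of_recursion {q : ℕ → ℝ} {p ε : ℝ} (hp0 : 0 ≤ p) (hp1 : p ≤ 1) (hε : 0 ≤ ε)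
    (h0 : q 0 = 1) (h1 : q 1 = 1 - p) (hanti : ∀ m, q (m + 1) ≤ q m) (hlip : ∀ m, q m - p ≤ q (m + 1))
    (hlow : ∀ m, q (m + 1) - p * q m ≤ q (m + 2))
    (hupp : ∀ m, q (m + 2) ≤ q (m + 1) - p * q m + ε) (m : ℕ) :
    |q m - (1 - p) ^ m| ≤ m * (p ^ 2 + ε) := by
  have hstep (m : ℕ) : |q (m + 1) - (1 - p) * q m| ≤ p ^ 2 + ε := by
    rcases m with _ | m
    · simp only [zero_add, h0, h1, mul_one, sub_self, abs_zero]; positivity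
    · rw [abs_le]
      constructor
      · nlinarith [hlow m, hlip m]
      · nlinarith [hupp m, hanti m]
  induction m with
  | zero => simp [h0]
  | succ m ih =>
    have h : q (m + 1) - (1 - p) ^ (m + 1)
        = (q (m + 1) - (1 - p) * q m) + (1 - p) * (q m - (1 - p) ^ m) := by ring
    rw [h]
    refine (abs_add_le _ _).trans ?_
    rw [abs_mul, abs_of_nonneg (sub_nonneg.2 hp1)]
    have := hstep m
    have h3 : (1 - p) * |q m - (1 - p) ^ m| ≤ |q m - (1 - p) ^ m| :=
      mul_le_of_le_one_left (abs_nonneg _) (by linarith)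
    push_cast
    linarith

lemma abs_expSeq_pairSumsLE_sub_le {s : ℝ} (hs : 0 ≤ s) (m : ℕ) :
    |expSeq.real (pairSumsLE s m) - (1 - (1 + s) * Real.exp (-s)) ^ m|
      ≤ m * (((1 + s) * Real.exp (-s)) ^ 2 + 2 * Real.exp (-s)) := by
  have hp (m : ℕ) : expSeq.real {e | s < e m + e (m + 1)} = (1 + s) * Real.exp (-s) :=
    expSeq_real_lt_add hs (by omega)
  have hdiff (m : ℕ) : expSeq.real (pairSumsLE s (m + 1)) = expSeq.real (pairSumsLE s m)
      - expSeq.real (pairSumsLE s m ∩ {e | s < e m + e (m + 1)}) := by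
    rw [pairSumsLE_succ, ← measureReal_sdiff_add_inter (s := pairSumsLE s m)
      (measurableSet_lt_add s m (m + 1))]
    ring
  have h0 : expSeq.real (pairSumsLE s 0) = 1 := by simp [pairSumsLE]
  refine abs_sub_pow_le_of_recursion (q := fun m => expSeq.real (pairSumsLE s m)) (by positivity) ?_ (by positivity) h0 ?_ ?_ ?_ ?_ ?_ m
  · rw [← hp 0]; exact measureReal_le_one
  · rw [hdiff 0, h0, ← hp 0]; simp [pairSumsLE]
  · intro m
    rw [hdiff m]
    linarith [measureReal_nonneg (μ := expSeq) (s := pairSumsLE s m ∩ {e | s < e m + e (m + 1)})]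
  · intro m
    rw [hdiff m, ← hp m]
    linarith [measureReal_mono (μ := expSeq)
      (inter_subset_right : pairSumsLE s m ∩ {e | s < e m + e (m + 1)} ⊆ _)]
  · intro m
    have h := expSeq_real_pairSumsLE_inter s m
    rw [hp (m + 1)] at h
    have : expSeq.real (pairSumsLE s (m + 1) ∩ {e | s < e (m + 1) + e (m + 2)})
        ≤ expSeq.real (pairSumsLE s m ∩ {e | s < e (m + 1) + e (m + 2)}) :=
      measureReal_mono (inter_subset_inter_left _ (by rw [pairSumsLE_succ]; exact sdiff_subset))
    rw [hdiff (m + 1)]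
    linarith
  · intro m
    have h := expSeq_real_pairSumsLE_inter s m
    rw [hp (m + 1)] at h
    -- Dropping the condition on pair `m` only adds outcomes where pairs `m` and `m + 1` both exceed
    -- `s`.
    have h2 : expSeq.real (pairSumsLE s m ∩ {e | s < e (m + 1) + e (m + 2)})
        ≤ expSeq.real (pairSumsLE s (m + 1) ∩ {e | s < e (m + 1) + e (m + 2)})
          + expSeq.real {e | s < e m + e (m + 1) ∧ s < e (m + 1) + e (m + 2)} := by
      refine measureReal_le_add_of_ae_imp (ae_of_all _ fun e he => ?_)
      by_cases h : s < e m + e (m + 1)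
      · exact Or.inr ⟨h, he.2⟩
      · exact Or.inl ⟨by rw [pairSumsLE_succ]; exact ⟨he.1, h⟩, he.2⟩
    have h3 := expSeq_real_lt_add_and_lt_add_le hs (i := m) (j := m + 1) (l := m + 2)
      (by omega) (by omega) (by omega)
    rw [hdiff (m + 1)]
    linarith

/-- The normalization of the Gumbel limit. -/
noncomputable def gumbelLevel (x : ℝ) (k : ℕ) : ℝ :=
  Real.log ((k : ℝ) + 1) + Real.log (Real.log ((k : ℝ) + 1)) + x

/-! ### Asymptotics of the Gumbel normalization. -/

lemma tendsto_natCast_add_one : Tendsto (fun k : ℕ => (k : ℝ) + 1) atTop atTop :=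
  tendsto_atTop_add_const_right _ _ tendsto_natCast_atTop_atTop

lemma tendsto_log_natCast_add_one : Tendsto (fun k : ℕ => Real.log ((k : ℝ) + 1)) atTop atTop :=
  Real.tendsto_log_atTop.comp tendsto_natCast_add_one

lemma tendsto_gumbelLevel_atTop (x : ℝ) : Tendsto (gumbelLevel x) atTop atTop :=
  tendsto_atTop_add_const_right _ _ (tendsto_log_natCast_add_one.atTop_add_atTop
    (Real.tendsto_log_atTop.comp tendsto_log_natCast_add_one))

lemma exp_neg_gumbelLevel (x : ℝ) : ∀ᶠ k : ℕ in atTop, Real.exp (-gumbelLevel x k)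
    = Real.exp (-x) / (((k : ℝ) + 1) * Real.log ((k : ℝ) + 1)) := by
  filter_upwards [tendsto_log_natCast_add_one.eventually_gt_atTop 0] with k hk
  have h : (0 : ℝ) < (k : ℝ) + 1 := by positivity
  rw [gumbelLevel, show -(Real.log ((k : ℝ) + 1) + Real.log (Real.log ((k : ℝ) + 1)) + x)
    = -x - (Real.log ((k : ℝ) + 1) + Real.log (Real.log ((k : ℝ) + 1))) by ring, Real.exp_sub,
    Real.exp_add, Real.exp_log h, Real.exp_log hk]

lemma tendsto_add_gumbelLevel_div_log (c x : ℝ) :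
    Tendsto (fun k : ℕ => (c + gumbelLevel x k) / Real.log ((k : ℝ) + 1)) atTop (𝓝 1) := by
  have h1 : Tendsto (fun y : ℝ => 1 + Real.log y / y + (c + x) / y) atTop (𝓝 (1 + 0 + 0)) := by
    refine (tendsto_const_nhds.add ?_).add (tendsto_const_nhds.div_atTop tendsto_id)
    simpa using Real.tendsto_pow_log_div_mul_add_atTop 1 0 1 one_ne_zero
  have h2 := h1.comp tendsto_log_natCast_add_one
  rw [add_zero, add_zero] at h2
  refine h2.congr' ?_
  filter_upwards [tendsto_log_natCast_add_one.eventually_gt_atTop 0] with k hk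
  simp only [Function.comp_apply, gumbelLevel]
  field_simp
  ring

lemma tendsto_natCast_div_natCast_add_one :
    Tendsto (fun k : ℕ => (k : ℝ) / ((k : ℝ) + 1)) atTop (𝓝 1) :=
  tendsto_natCast_div_add_atTop 1

lemma tendsto_gumbelLevel_sq_div (x : ℝ) :
    Tendsto (fun k : ℕ => gumbelLevel x k ^ 2 / ((k : ℝ) + 1)) atTop (𝓝 0) := by
  have h1 : Tendsto (fun k : ℕ => Real.log ((k : ℝ) + 1) ^ 2 / ((k : ℝ) + 1)) atTop (𝓝 0) := by
    simpa [Function.comp_def] using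
      (Real.tendsto_pow_log_div_mul_add_atTop 1 0 2 one_ne_zero).comp tendsto_natCast_add_one
  have h2 := ((tendsto_add_gumbelLevel_div_log 0 x).pow 2).mul h1
  rw [mul_zero] at h2
  refine h2.congr' ?_
  filter_upwards [tendsto_log_natCast_add_one.eventually_gt_atTop 0] with k hk
  field_simp
  ring

lemma tendsto_natCast_mul_exp_neg_gumbelLevel (x : ℝ) :
    Tendsto (fun k : ℕ => (k : ℝ) * Real.exp (-gumbelLevel x k)) atTop (𝓝 0) := by
  have h := (tendsto_natCast_div_natCast_add_one.mul_const (Real.exp (-x))).mul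
    tendsto_log_natCast_add_one.inv_tendsto_atTop
  rw [mul_zero] at h
  refine h.congr' ?_
  filter_upwards [exp_neg_gumbelLevel x] with k hk
  rw [hk, Pi.inv_apply]
  field_simp

/-- The prefactor `1 + s`, of order `log n`, cancels the factor `1 / log n` that the iterated
logarithm puts into `exp (-s)`. This explains the `log log n` in the normalization. -/
lemma tendsto_natCast_mul_add_gumbelLevel_mul_exp (x : ℝ) :
    Tendsto (fun k : ℕ => (k : ℝ) * ((1 + gumbelLevel x k) * Real.exp (-gumbelLevel x k))) atTop
      (𝓝 (Real.exp (-x))) := by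
  have h := (tendsto_natCast_div_natCast_add_one.mul_const (Real.exp (-x))).mul
    (tendsto_add_gumbelLevel_div_log 1 x)
  rw [mul_one, one_mul] at h
  refine h.congr' ?_
  filter_upwards [exp_neg_gumbelLevel x] with k hk
  rw [hk]
  field_simp

theorem tendsto_expSeq_pairSumsLE (x : ℝ) :
    Tendsto (fun k : ℕ => expSeq.real (pairSumsLE (gumbelLevel x k) k)) atTop
      (𝓝 (Real.exp (-Real.exp (-x)))) := by
  set p : ℕ → ℝ := fun k => (1 + gumbelLevel x k) * Real.exp (-gumbelLevel x k) with hp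
  have hkp := tendsto_natCast_mul_add_gumbelLevel_mul_exp x
  have hp0 : Tendsto p atTop (𝓝 0) := by
    have := hkp.mul (tendsto_inv_atTop_zero.comp tendsto_natCast_atTop_atTop)
    rw [mul_zero] at this
    refine this.congr' ?_
    filter_upwards [eventually_gt_atTop 0] with k hk
    have : (k : ℝ) ≠ 0 := by positivity
    simp only [Function.comp_apply, hp]
    field_simp
  have hmain : Tendsto (fun k : ℕ => (1 - p k) ^ k) atTop (𝓝 (Real.exp (-Real.exp (-x)))) := by
    have := Real.tendsto_one_add_pow_exp_of_tendsto (g := fun k => -p k) (t := -Real.exp (-x))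
      (by simpa using hkp.neg)
    simpa [sub_eq_add_neg] using this
  have herr : Tendsto (fun k : ℕ => (k : ℝ) * (p k ^ 2 + 2 * Real.exp (-gumbelLevel x k))) atTop
      (𝓝 0) := by
    have := (hkp.mul hp0).add ((tendsto_natCast_mul_exp_neg_gumbelLevel x).const_mul 2)
    rw [mul_zero, mul_zero, add_zero] at this
    refine this.congr fun k => ?_
    simp only [hp]; ring
  have hdiff : Tendsto (fun k : ℕ => expSeq.real (pairSumsLE (gumbelLevel x k) k) - (1 - p k) ^ k)
      atTop (𝓝 0) := by
    refine squeeze_zero_norm' ?_ herr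
    filter_upwards [(tendsto_gumbelLevel_atTop x).eventually_ge_atTop 0] with k hk
    exact abs_expSeq_pairSumsLE_sub_le hk k
  simpa using hdiff.add hmain

/-! ### The winning vote share -/

lemma winningShare_normalizedSums_le_iff {k : ℕ} (hk : 0 < k) {e : ℕ → ℝ} (he : ∀ i ≤ k, 0 < e i)
    (t : ℝ) : winningShare (normalizedSums k e) ≤ t
      ↔ ∀ i < k, cellLength k e i ≤ t * (2 * ∑ j ∈ Finset.range (k + 1), e j) := by
  have : Nonempty (Fin k) := ⟨⟨0, hk⟩⟩
  have hT := ((mem_orderedSimplex_normalizedSums_iff e).2 he).1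
  rw [winningShare, ciSup_le_iff (Set.finite_range _).bddAbove, Fin.forall_iff]
  refine forall₂_congr fun i hi => ?_
  rw [voteShare_normalizedSums he, div_le_iff₀ (by positivity)]

lemma add_le_cellLength {k : ℕ} (i : ℕ) {e : ℕ → ℝ} (he : ∀ i ≤ k, 0 < e i) :
    e i + e (i + 1) ≤ cellLength k e i := by
  have h0 := he 0 (by omega)
  have hk := he k le_rfl
  rw [cellLength]
  split_ifs <;> linarith

/-- Four summands occur when `k = 1`: the sole candidate counts both spacings twice. Otherwise there
are three. -/
lemma cellLength_le_of_boundary {k i : ℕ} (hi : i < k) (hb : i = 0 ∨ i + 1 = k) {e : ℕ → ℝ} {b : ℝ}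
    (hb0 : 0 ≤ b) (h0 : e 0 ≤ b) (h1 : e 1 ≤ b) (h2 : e (k - 1) ≤ b) (h3 : e k ≤ b) :
    cellLength k e i ≤ 4 * b := by
  rcases hb with rfl | rfl
  · rw [cellLength, if_pos rfl]
    split_ifs <;> simp only [zero_add] <;> linarith
  · rw [Nat.add_sub_cancel] at h2
    rw [cellLength, if_pos rfl]
    split_ifs <;> linarith

lemma cellLength_of_interior {k i : ℕ} (hb : ¬ (i = 0 ∨ i + 1 = k)) (e : ℕ → ℝ) :
    cellLength k e i = e i + e (i + 1) := by
  rw [not_or] at hb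
  simp [cellLength, hb.1, hb.2]

/-- One of the two extreme spacings on either side exceeds `b`. -/
def boundaryGT (b : ℝ) (k : ℕ) : Set (ℕ → ℝ) :=
  {e | ¬ (e 0 ≤ b ∧ e 1 ≤ b ∧ e (k - 1) ≤ b ∧ e k ≤ b)}

lemma expSeq_real_boundaryGT_le {b : ℝ} (hb : 0 ≤ b) (k : ℕ) :
    expSeq.real (boundaryGT b k) ≤ 4 * Real.exp (-b) := by
  have h (i : ℕ) := expSeq_real_lt hb i
  calc expSeq.real (boundaryGT b k)
      ≤ expSeq.real ((({e | b < e 0} ∪ {e | b < e 1}) ∪ {e | b < e (k - 1)}) ∪ {e | b < e k}) := by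
        refine measureReal_mono fun e he => ?_
        simp only [boundaryGT, mem_ofPred_eq, mem_union] at he ⊢
        contrapose! he
        tauto
    _ ≤ _ := by
        refine (measureReal_union_le _ _).trans ?_
        refine (add_le_add_left (measureReal_union_le _ _) _).trans ?_
        refine (add_le_add_left (add_le_add_left (measureReal_union_le _ _) _) _).trans ?_
        rw [h, h, h, h]
        linarith

lemma tendsto_expSeq_boundaryGT {b : ℕ → ℝ} (hb : Tendsto b atTop atTop) :
    Tendsto (fun k => expSeq.real (boundaryGT (b k) k)) atTop (𝓝 0) := by
  have h : Tendsto (fun k => 4 * Real.exp (-b k)) atTop (𝓝 0) := by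
    simpa using (Real.tendsto_exp_neg_atTop_nhds_zero.comp hb).const_mul 4
  refine squeeze_zero' (Eventually.of_forall fun _ => measureReal_nonneg) ?_ h
  filter_upwards [hb.eventually_ge_atTop 0] with k hk
  exact expSeq_real_boundaryGT_le hk k

/-- The sum of the spacings deviates from its mean by at least `c`. -/
def sumDeviates (c : ℝ) (n : ℕ) : Set (ℕ → ℝ) := {e | c ≤ |∑ i ∈ Finset.range n, e i - n|}

/-- The tolerance `η * n / L`, with `L = gumbelLevel x k`, is the one that moves the threshold `L *
T / n` by at most `η`. Chebyshev's bound is then `L ^ 2 / (η ^ 2 * n)`. -/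
lemma tendsto_expSeq_sumDeviates {η : ℝ} (hη : 0 < η) (x : ℝ) :
    Tendsto (fun k : ℕ => expSeq.real (sumDeviates (η * ((k : ℝ) + 1) / gumbelLevel x k) (k + 1))) atTop
      (𝓝 0) := by
  have h := (tendsto_gumbelLevel_sq_div x).const_mul (1 / η ^ 2)
  rw [mul_zero] at h
  refine squeeze_zero' (Eventually.of_forall fun _ => measureReal_nonneg) ?_ h
  filter_upwards [(tendsto_gumbelLevel_atTop x).eventually_gt_atTop 0] with k hk
  refine (expSeq_real_le_abs_sum_sub (k + 1) (by positivity)).trans (le_of_eq ?_)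
  push_cast
  field_simp

lemma mul_sum_mem_Icc {k : ℕ} {x η : ℝ} {e : ℕ → ℝ} (hL : 0 < gumbelLevel x k)
    (he : e ∉ sumDeviates (η * ((k : ℝ) + 1) / gumbelLevel x k) (k + 1)) :
    gumbelLevel x k / (2 * ((k : ℝ) + 1)) * (2 * ∑ j ∈ Finset.range (k + 1), e j)
      ∈ Icc (gumbelLevel (x - η) k) (gumbelLevel (x + η) k) := by
  have hk : (0 : ℝ) < (k : ℝ) + 1 := by positivity
  set L := gumbelLevel x k with hLdef
  set T := ∑ j ∈ Finset.range (k + 1), e j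
  have h1 : gumbelLevel (x - η) k = L - η := by rw [hLdef, gumbelLevel, gumbelLevel]; ring
  have h2 : gumbelLevel (x + η) k = L + η := by rw [hLdef, gumbelLevel, gumbelLevel]; ring
  have h3 : L / (2 * ((k : ℝ) + 1)) * (2 * T) = L + L / ((k : ℝ) + 1) * (T - ((k : ℝ) + 1)) := by
    field_simp; ring
  simp only [sumDeviates, mem_ofPred_eq, not_le, Nat.cast_add, Nat.cast_one] at he
  have h4 : |L / ((k : ℝ) + 1) * (T - ((k : ℝ) + 1))| ≤ η := by
    rw [abs_mul, abs_of_pos (by positivity)]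
    refine (mul_le_mul_of_nonneg_left he.le (by positivity)).trans (le_of_eq ?_)
    field_simp
  rw [h1, h2, h3]
  constructor <;> linarith [(abs_le.1 h4).1, (abs_le.1 h4).2]

theorem tendsto_expSeq_winningShare (x : ℝ) :
    Tendsto (fun k : ℕ => expSeq.real {e | winningShare (normalizedSums k e)
      ≤ gumbelLevel x k / (2 * ((k : ℝ) + 1))}) atTop (𝓝 (Real.exp (-Real.exp (-x)))) := by
  refine tendsto_order.2 ⟨fun a ha => ?_, fun a ha => ?_⟩
  -- The fluctuation of `T` is absorbed by a small shift of `x`, harmless because the Gumbel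
  -- distribution function is continuous.
  · obtain ⟨η, hη, hηa⟩ : ∃ η > 0, a < Real.exp (-Real.exp (-(x - η))) := by
      have h1 : Tendsto (fun η : ℝ => Real.exp (-Real.exp (-(x - η)))) (𝓝[>] 0)
          (𝓝 (Real.exp (-Real.exp (-x)))) := by
        have : Continuous fun η : ℝ => Real.exp (-Real.exp (-(x - η))) := by fun_prop
        simpa using (this.tendsto 0).mono_left nhdsWithin_le_nhds
      obtain ⟨η, h, hη⟩ := ((h1.eventually_const_lt ha).and self_mem_nhdsWithin).exists
      exact ⟨η, hη, h⟩
    have hb : Tendsto (fun k => gumbelLevel (x - η) k / 4) atTop atTop :=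
      (tendsto_gumbelLevel_atTop (x - η)).atTop_div_const (by norm_num)
    have h := ((tendsto_expSeq_pairSumsLE (x - η)).sub (tendsto_expSeq_sumDeviates hη x)).sub
      (tendsto_expSeq_boundaryGT hb)
    rw [sub_zero, sub_zero] at h
    filter_upwards [h.eventually_const_lt hηa, eventually_gt_atTop 0,
      (tendsto_gumbelLevel_atTop x).eventually_gt_atTop 0, hb.eventually_ge_atTop 0]
      with k hka hk hL hb0
    have h1 : expSeq.real (pairSumsLE (gumbelLevel (x - η) k) k)
        ≤ expSeq.real ({e | winningShare (normalizedSums k e)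
            ≤ gumbelLevel x k / (2 * ((k : ℝ) + 1))}
          ∪ sumDeviates (η * ((k : ℝ) + 1) / gumbelLevel x k) (k + 1))
        + expSeq.real (boundaryGT (gumbelLevel (x - η) k / 4) k) := by
      refine measureReal_le_add_of_ae_imp ?_
      filter_upwards [ae_expSeq_pos] with e he hpair
      by_cases hd : e ∈ sumDeviates (η * ((k : ℝ) + 1) / gumbelLevel x k) (k + 1)
      · exact Or.inl (Or.inr hd)
      by_cases hbd : e ∈ boundaryGT (gumbelLevel (x - η) k / 4) k
      · exact Or.inr hbd
      refine Or.inl (Or.inl ?_)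
      rw [mem_ofPred_eq, winningShare_normalizedSums_le_iff hk fun i _ => he i]
      intro i hi
      refine le_trans ?_ (mul_sum_mem_Icc hL hd).1
      by_cases hib : i = 0 ∨ i + 1 = k
      · simp only [boundaryGT, mem_ofPred_eq, not_not] at hbd
        obtain ⟨b0, b1, b2, b3⟩ := hbd
        exact (cellLength_le_of_boundary hi hib hb0 b0 b1 b2 b3).trans_eq (by ring)
      · rw [cellLength_of_interior hib]
        exact hpair i hi
    linarith [measureReal_union_le (μ := expSeq) {e | winningShare (normalizedSums k e)
            ≤ gumbelLevel x k / (2 * ((k : ℝ) + 1))}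
          (sumDeviates (η * ((k : ℝ) + 1) / gumbelLevel x k) (k + 1))]
  · obtain ⟨η, hη, hηa⟩ : ∃ η > 0, Real.exp (-Real.exp (-(x + η))) < a := by
      have h1 : Tendsto (fun η : ℝ => Real.exp (-Real.exp (-(x + η)))) (𝓝[>] 0)
          (𝓝 (Real.exp (-Real.exp (-x)))) := by
        have : Continuous fun η : ℝ => Real.exp (-Real.exp (-(x + η))) := by fun_prop
        simpa using (this.tendsto 0).mono_left nhdsWithin_le_nhds
      obtain ⟨η, h, hη⟩ := ((h1.eventually_lt_const ha).and self_mem_nhdsWithin).exists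
      exact ⟨η, hη, h⟩
    -- The upper bound needs no boundary event, since every cell is at least its pair sum.
    have h := (tendsto_expSeq_pairSumsLE (x + η)).add (tendsto_expSeq_sumDeviates hη x)
    rw [add_zero] at h
    filter_upwards [h.eventually_lt_const hηa, eventually_gt_atTop 0,
      (tendsto_gumbelLevel_atTop x).eventually_gt_atTop 0] with k hka hk hL
    refine lt_of_le_of_lt (measureReal_le_add_of_ae_imp ?_) hka
    filter_upwards [ae_expSeq_pos] with e he hw
    by_cases hd : e ∈ sumDeviates (η * ((k : ℝ) + 1) / gumbelLevel x k) (k + 1)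
    · exact Or.inr hd
    rw [winningShare_normalizedSums_le_iff hk fun i _ => he i] at hw
    exact Or.inl fun i hi => (add_le_cellLength i fun i _ => he i).trans
      ((hw i hi).trans (mul_sum_mem_Icc hL hd).2)

/-! ### The position of the winner -/

/-- Sums of two cyclically consecutive terms among `e 0, …, e (n - 1)`. -/
def cyclicSum (n : ℕ) (e : ℕ → ℝ) (j : ℕ) : ℝ := e j + e ((j + 1) % n)

/-- The cyclic sum at `j` is maximal. -/
def IsCyclicMax (n : ℕ) (e : ℕ → ℝ) (j : ℕ) : Prop := ∀ i < n, cyclicSum n e i ≤ cyclicSum n e j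

/-- The cyclic rotation by `c` of the first `n` natural numbers. -/
def rotateBelow (n c i : ℕ) : ℕ := if i < n then (i + c) % n else i

lemma rotateBelow_injective {n : ℕ} (c : ℕ) : Function.Injective (rotateBelow n c) := by
  intro i j h
  simp only [rotateBelow] at h
  split_ifs at h with hi hj hj
  · have h' : i + c ≡ j + c [MOD n] := h
    exact (Nat.ModEq.add_right_cancel' c h').eq_of_lt_of_lt hi hj
  · exact absurd (h ▸ Nat.mod_lt _ (by omega)) hj
  · exact absurd (h ▸ Nat.mod_lt _ (by omega)) hi
  · exact h

lemma cyclicSum_comp_rotateBelow {n c j : ℕ} (hj : j < n) (e : ℕ → ℝ) :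
    cyclicSum n (e ∘ rotateBelow n c) j = cyclicSum n e ((j + c) % n) := by
  have h : (j + 1) % n < n := Nat.mod_lt _ (by omega)
  simp only [cyclicSum, Function.comp_apply, rotateBelow, if_pos hj, if_pos h]
  congr 2
  rw [Nat.mod_add_mod, Nat.mod_add_mod]
  congr 1; omega

lemma isCyclicMax_comp_rotateBelow {n c : ℕ} (hc : c < n) (e : ℕ → ℝ) :
    IsCyclicMax n (e ∘ rotateBelow n c) 0 ↔ IsCyclicMax n e c := by
  have hn : 0 < n := by omega
  have h0 : (0 + c) % n = c := by rw [zero_add, Nat.mod_eq_of_lt hc]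
  simp only [IsCyclicMax]
  constructor
  · intro h i hi
    have := h ((i + (n - c)) % n) (Nat.mod_lt _ hn)
    rw [cyclicSum_comp_rotateBelow (Nat.mod_lt _ hn), cyclicSum_comp_rotateBelow hn, h0,
      Nat.mod_add_mod, show i + (n - c) + c = i + n by omega, Nat.add_mod_right,
      Nat.mod_eq_of_lt hi] at this
    exact this
  · intro h i hi
    rw [cyclicSum_comp_rotateBelow hi, cyclicSum_comp_rotateBelow hn, h0]
    exact h _ (Nat.mod_lt _ hn)

lemma measurableSet_isCyclicMax (n j : ℕ) : MeasurableSet {e | IsCyclicMax n e j} := by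
  simp only [IsCyclicMax, ofPred_forall, cyclicSum]
  exact .iInter fun i => .iInter fun _ => measurableSet_le (by fun_prop) (by fun_prop)

/-- Rotating the first `n` coordinates preserves the law and carries index `c` to index `0`. -/
lemma expSeq_isCyclicMax_eq {n c : ℕ} (hc : c < n) :
    expSeq {e | IsCyclicMax n e c} = expSeq {e | IsCyclicMax n e 0} := by
  rw [← (measurePreserving_comp_of_injective (rotateBelow_injective (n := n) c)).measure_preimage
    (measurableSet_isCyclicMax n 0).nullMeasurableSet]
  congr 1
  ext e
  exact (isCyclicMax_comp_rotateBelow hc e).symm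

/-- A tie is a linear equation in the first `n` coordinates, so it defines a null hyperplane once
its normal `v` is nonzero. For `n = 2` the two cyclic sums coincide. -/
lemma expSeq_cyclicSum_eq_null {n i j : ℕ} (hn : 3 ≤ n) (hi : i < n) (hj : j < n) (hij : i ≠ j) :
    expSeq {e | cyclicSum n e i = cyclicSum n e j} = 0 := by
  have hmod (a : ℕ) : (a + 1) % n < n := Nat.mod_lt _ (by omega)
  set a : Fin n := ⟨i, hi⟩
  set b : Fin n := ⟨(i + 1) % n, hmod i⟩
  set c : Fin n := ⟨j, hj⟩
  set d : Fin n := ⟨(j + 1) % n, hmod j⟩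
  set v : Fin n → ℝ := Pi.single a 1 + Pi.single b 1 - Pi.single c 1 - Pi.single d 1 with hv
  have hsucc (m : ℕ) (hm : m < n) : (m + 1 < n ∧ (m + 1) % n = m + 1) ∨
      (m + 1 = n ∧ (m + 1) % n = 0) := by
    rcases Nat.lt_or_ge (m + 1) n with h | h
    · exact Or.inl ⟨h, Nat.mod_eq_of_lt h⟩
    · exact Or.inr ⟨by omega, by rw [show m + 1 = n by omega, Nat.mod_self]⟩
  have hi' := hsucc i hi
  have hj' := hsucc j hj
  have hab : a ≠ b := fun h => by have := congrArg Fin.val h; simp only [a, b] at this; omega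
  have hac : a ≠ c := fun h => hij (congrArg Fin.val h)
  have hcd : c ≠ d := fun h => by have := congrArg Fin.val h; simp only [c, d] at this; omega
  have hv0 : v ≠ 0 := by
    intro h
    have ha := congrFun h a
    have hc := congrFun h c
    -- The normal could vanish only if each of `i`, `j` were the cyclic successor of the other,
    -- which forces `n ≤ 2`.
    by_cases had : a = d
    · by_cases hbc : b = c
      · have h1 := congrArg Fin.val had
        have h2 := congrArg Fin.val hbc
        simp only [a, b, c, d] at h1 h2
        omega
      · simp [hv, hac.symm, Ne.symm hbc, hcd] at hc
    · simp [hv, hab, hac, had] at ha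
  have hpre : {e : ℕ → ℝ | cyclicSum n e i = cyclicSum n e j}
      = (fun (e : ℕ → ℝ) (l : Fin n) => e l) ⁻¹' {y | v ⬝ᵥ y = 0} := by
    ext e
    simp only [mem_ofPred_eq, mem_preimage, hv, sub_dotProduct, add_dotProduct,
      single_dotProduct, one_mul, cyclicSum, a, b, c, d]
    constructor <;> intro h <;> linarith
  have hms : MeasurableSet {y : Fin n → ℝ | v ⬝ᵥ y = 0} :=
    measurableSet_eq_fun (Continuous.dotProduct continuous_const continuous_id).measurable
      measurable_const
  rw [hpre, (measurePreserving_expSeq_fin n).measure_preimage hms.nullMeasurableSet, pi_expMeasure]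
  exact withDensity_absolutelyContinuous _ _ (volume_setOf_dotProduct_eq_zero hv0)

/-- The `n` events are equiprobable and almost surely disjoint. -/
lemma expSeq_real_isCyclicMax_le {n c : ℕ} (hn : 3 ≤ n) (hc : c < n) :
    expSeq.real {e | IsCyclicMax n e c} ≤ 1 / n := by
  have hdisj : Set.Pairwise (Finset.range n : Set ℕ)
      (Function.onFun (AEDisjoint expSeq) fun j => {e | IsCyclicMax n e j}) := by
    intro i hi j hj hij
    simp only [Finset.coe_range, mem_Iio] at hi hj
    exact measure_mono_null (fun e he => le_antisymm (he.2 i hi) (he.1 j hj))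
      (expSeq_cyclicSum_eq_null hn hi hj hij)
  have h := measure_biUnion_finset₀ hdisj fun j _ => (measurableSet_isCyclicMax n j).nullMeasurableSet
  have h1 : ∑ j ∈ Finset.range n, expSeq {e | IsCyclicMax n e j}
      = n * expSeq {e | IsCyclicMax n e c} := by
    rw [Finset.sum_congr rfl fun j hj => (expSeq_isCyclicMax_eq (Finset.mem_range.1 hj)).trans
      (expSeq_isCyclicMax_eq hc).symm]
    simp
  rw [h1] at h
  have h2 : (n : ℝ≥0∞) * expSeq {e | IsCyclicMax n e c} ≤ 1 := h ▸ prob_le_one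
  have h3 := ENNReal.toReal_mono ENNReal.one_ne_top h2
  rw [ENNReal.toReal_mul, ENNReal.toReal_natCast, ENNReal.toReal_one] at h3
  rw [le_div_iff₀ (by positivity), mul_comm]
  exact h3

lemma expSeq_real_exists_isCyclicMax_le {n : ℕ} (hn : 3 ≤ n) {s : Finset ℕ}
    (hs : s ⊆ Finset.range n) :
    expSeq.real {e | ∃ j ∈ s, IsCyclicMax n e j} ≤ s.card / n := by
  have h : {e | ∃ j ∈ s, IsCyclicMax n e j} = ⋃ j ∈ s, {e | IsCyclicMax n e j} := by
    ext e; simp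
  rw [h]
  refine (measureReal_biUnion_finset_le _ _).trans ?_
  refine (Finset.sum_le_card_nsmul _ _ (1 / (n : ℝ)) fun j hj =>
    expSeq_real_isCyclicMax_le hn (Finset.mem_range.1 (hs hj))).trans (le_of_eq ?_)
  rw [nsmul_eq_mul]; ring

lemma isPluralityWinner_normalizedSums_iff {k : ℕ} {e : ℕ → ℝ} (he : ∀ i ≤ k, 0 < e i) (w : Fin k) :
    IsPluralityWinner (normalizedSums k e) w ↔ ∀ j < k, cellLength k e j ≤ cellLength k e w := by
  have hT := ((mem_orderedSimplex_normalizedSums_iff e).2 he).1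
  simp only [IsPluralityWinner, voteShare_normalizedSums he, Fin.forall_iff]
  exact forall₂_congr fun i hi => div_le_div_iff_of_pos_right (by positivity)

/-- Some pair sum exceeds `4 * b`, hence so does the winning cell, while outermost cells do not. The
winner is therefore interior and its cell is a plain pair sum. The one cyclic sum that belongs to no
candidate, `e k + e 0`, is at most `2 * b`. -/
lemma isCyclicMax_of_isPluralityWinner {k : ℕ} {e : ℕ → ℝ} (he : ∀ i ≤ k, 0 < e i) {b : ℝ}
    (hb : 0 ≤ b) (hbd : e ∉ boundaryGT b k) (hpair : e ∉ pairSumsLE (4 * b) k) {w : Fin k}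
    (hw : IsPluralityWinner (normalizedSums k e) w) : IsCyclicMax (k + 1) e w := by
  rw [isPluralityWinner_normalizedSums_iff he] at hw
  simp only [boundaryGT, mem_ofPred_eq, not_not] at hbd
  obtain ⟨b0, b1, b2, b3⟩ := hbd
  simp only [pairSumsLE, mem_ofPred_eq, not_forall, not_le] at hpair
  obtain ⟨i, hi, hlt⟩ := hpair
  have hcw : 4 * b < cellLength k e w := hlt.trans_le ((add_le_cellLength i he).trans (hw i hi))
  have hint : ¬ (w.1 = 0 ∨ w.1 + 1 = k) := fun h =>
    absurd (cellLength_le_of_boundary w.2 h hb b0 b1 b2 b3) (not_le.2 hcw)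
  have hsum (j : ℕ) (hj : j < k) : cyclicSum (k + 1) e j = e j + e (j + 1) := by
    rw [cyclicSum, Nat.mod_eq_of_lt (by omega)]
  intro j hj
  rw [hsum w w.2, ← cellLength_of_interior hint]
  rcases (Nat.lt_succ_iff.1 hj).lt_or_eq with hj | rfl
  · rw [hsum j hj]
    exact (add_le_cellLength j he).trans (hw j hj)
  · rw [cyclicSum, Nat.mod_self]
    linarith

/-- Since `log log n → ∞`, the level `log n` eventually lies below `gumbelLevel (-x) k` for every
fixed `x`, and the Gumbel distribution function tends to `0` at `-∞`. -/
lemma tendsto_expSeq_pairSumsLE_log :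
    Tendsto (fun k : ℕ => expSeq.real (pairSumsLE (Real.log ((k : ℝ) + 1)) k)) atTop (𝓝 0) := by
  refine tendsto_order.2 ⟨fun a ha => Eventually.of_forall fun _ => ha.trans_le measureReal_nonneg,
    fun a ha => ?_⟩
  have h1 : Tendsto (fun x : ℝ => Real.exp (-Real.exp x)) atTop (𝓝 0) :=
    Real.tendsto_exp_neg_atTop_nhds_zero.comp Real.tendsto_exp_atTop
  obtain ⟨x, hx⟩ := (h1.eventually_lt_const ha).exists
  have h2 := tendsto_expSeq_pairSumsLE (-x)
  rw [neg_neg] at h2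
  filter_upwards [h2.eventually_lt_const hx, (Real.tendsto_log_atTop.comp
    tendsto_log_natCast_add_one).eventually_ge_atTop x] with k hk hkx
  refine (measureReal_mono fun e he j hj => (he j hj).trans ?_).trans_lt hk
  simp only [Function.comp_apply] at hkx
  rw [gumbelLevel]
  linarith

lemma tendsto_expSeq_sumDeviates_mul {δ : ℝ} (hδ : 0 < δ) {m : ℕ → ℕ} (hm : ∀ k, m k ≤ 3 * (k + 1)) :
    Tendsto (fun k : ℕ => expSeq.real (sumDeviates (δ * ((k : ℝ) + 1)) (m k))) atTop (𝓝 0) := by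
  have h : Tendsto (fun k : ℕ => 3 / δ ^ 2 / ((k : ℝ) + 1)) atTop (𝓝 0) :=
    tendsto_const_nhds.div_atTop tendsto_natCast_add_one
  refine squeeze_zero (fun _ => measureReal_nonneg) (fun k => ?_) h
  refine (expSeq_real_le_abs_sum_sub (m k) (by positivity)).trans ?_
  have h3 : (m k : ℝ) ≤ 3 * ((k : ℝ) + 1) := by exact_mod_cast hm k
  refine (div_le_div_of_nonneg_right h3 (by positivity)).trans (le_of_eq ?_)
  field_simp

/-- The exceptional event outside of which the winner has a maximal cyclic sum of spacings and the
partial sums of `m` and of `k + 1` spacings are close to their means. -/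
def exceptional (δ : ℝ) (m k : ℕ) : Set (ℕ → ℝ) :=
  ((boundaryGT (Real.log ((k : ℝ) + 1) / 4) k ∪ pairSumsLE (Real.log ((k : ℝ) + 1)) k)
    ∪ sumDeviates (δ * ((k : ℝ) + 1)) m) ∪ sumDeviates (δ * ((k : ℝ) + 1)) (k + 1)

lemma tendsto_expSeq_exceptional {δ : ℝ} (hδ : 0 < δ) {m : ℕ → ℕ} (hm : ∀ k, m k ≤ 3 * (k + 1)) :
    Tendsto (fun k : ℕ => expSeq.real (exceptional δ (m k) k)) atTop (𝓝 0) := by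
  have h := (((tendsto_expSeq_boundaryGT
    (tendsto_log_natCast_add_one.atTop_div_const four_pos)).add tendsto_expSeq_pairSumsLE_log).add
    (tendsto_expSeq_sumDeviates_mul hδ hm)).add
    (tendsto_expSeq_sumDeviates_mul hδ (m := fun k => k + 1) fun k => by omega)
  simp only [add_zero] at h
  refine squeeze_zero (fun _ => measureReal_nonneg) (fun k => ?_) h
  refine (measureReal_union_le _ _).trans (add_le_add_left ?_ _)
  refine (measureReal_union_le _ _).trans (add_le_add_left ?_ _)
  exact measureReal_union_le _ _

lemma isCyclicMax_of_notMem_exceptional {δ : ℝ} {m k : ℕ} {e : ℕ → ℝ} (he : ∀ i ≤ k, 0 < e i)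
    (hx : e ∉ exceptional δ m k) {w : Fin k} (hw : IsPluralityWinner (normalizedSums k e) w) :
    IsCyclicMax (k + 1) e w := by
  simp only [exceptional, mem_union, not_or] at hx
  have hlog : 0 ≤ Real.log ((k : ℝ) + 1) := Real.log_nonneg (by simp)
  refine isCyclicMax_of_isPluralityWinner he (by positivity) hx.1.1.1 ?_ hw
  rw [mul_div_cancel₀ _ (four_ne_zero)]
  exact hx.1.1.2

/-- Every plurality winner stands at a point of `s`. -/
def winnersMem (k : ℕ) (s : Set ℝ) : Set (Fin k → ℝ) := {x | ∀ i, IsPluralityWinner x i → x i ∈ s}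

lemma winnersMem_comp_perm {k : ℕ} {s : Set ℝ} (σ : Equiv.Perm (Fin k)) (x : Fin k → ℝ) :
    x ∘ σ ∈ winnersMem k s ↔ x ∈ winnersMem k s := by
  simp only [winnersMem, mem_ofPred_eq, isPluralityWinner_comp_perm, Function.comp_apply]
  exact σ.forall_congr_right (q := fun i => IsPluralityWinner x i → x i ∈ s)

lemma measurableSet_winnersMem {k : ℕ} {s : Set ℝ} (hs : MeasurableSet s) :
    MeasurableSet (winnersMem k s) := by
  simp only [winnersMem, ofPred_forall]
  refine .iInter fun i => ?_
  have : {x : Fin k → ℝ | IsPluralityWinner x i → x i ∈ s}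
      = {x | IsPluralityWinner x i}ᶜ ∪ (fun x => x i) ⁻¹' s := by
    ext x; simp [imp_iff_not_or]
  rw [this]
  exact (measurableSet_isPluralityWinner i).compl.union (measurable_pi_apply i hs)

/-! ### From the index of the winner to its position. -/

lemma sum_range_mono_of_pos {e : ℕ → ℝ} (he : ∀ i, 0 < e i) {a b : ℕ} (hab : a ≤ b) :
    ∑ i ∈ Finset.range a, e i ≤ ∑ i ∈ Finset.range b, e i :=
  Finset.sum_le_sum_of_subset_of_nonneg (Finset.range_mono hab) fun i _ _ => (he i).le

lemma eventually_le_expSeq_winnersMem_Iic {a ε : ℝ} (hε : 0 < ε) (hεa : ε ≤ a) (ha : a ≤ 1) :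
    ∀ᶠ k : ℕ in atTop, a - 2 * ε < expSeq.real {e | normalizedSums k e ∈ winnersMem k (Iic a)} := by
  -- Off the exceptional event with `δ = ε / 4`, an index below `m` has position at most `(a - 3ε/4)
  -- / (1 - ε/4)`, which is at most `a` because `a ≤ 1`.
  set m : ℕ → ℕ := fun k => ⌊(a - ε) * ((k : ℝ) + 1)⌋₊ with hm
  have hmle (k : ℕ) : (m k : ℝ) ≤ (a - ε) * ((k : ℝ) + 1) :=
    Nat.floor_le (mul_nonneg (by linarith) (by positivity))
  have hmn (k : ℕ) : m k ≤ k + 1 := by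
    have h := hmle k
    have : (m k : ℝ) ≤ ((k + 1 : ℕ) : ℝ) := by push_cast; nlinarith [(k.cast_nonneg : (0 : ℝ) ≤ k)]
    exact_mod_cast this
  have hbad := tendsto_expSeq_exceptional (δ := ε / 4) (by positivity) (m := m)
    fun k => (hmn k).trans (by omega)
  have hlim : Tendsto (fun k : ℕ => (a - ε) - 1 / ((k : ℝ) + 1)
      - expSeq.real (exceptional (ε / 4) (m k) k)) atTop (𝓝 (a - ε - 0 - 0)) :=
    (tendsto_const_nhds.sub tendsto_one_div_add_atTop_nhds_zero_nat).sub hbad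
  filter_upwards [hlim.eventually_const_lt (show a - 2 * ε < a - ε - 0 - 0 by linarith),
    -- `k ≥ 2` provides the three spacings needed for ties to be null.
    eventually_ge_atTop 2] with k hk hk2
  refine hk.trans_le ?_
  have hn : (0 : ℝ) < (k : ℝ) + 1 := by positivity
  have hcyc := expSeq_real_exists_isCyclicMax_le (n := k + 1) (by omega)
    (s := Finset.Ico (m k) (k + 1)) (fun j hj => Finset.mem_range.2 (Finset.mem_Ico.1 hj).2)
  have hcard : ((Finset.Ico (m k) (k + 1)).card : ℝ) / ((k + 1 : ℕ) : ℝ)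
      ≤ 1 - (a - ε) + 1 / ((k : ℝ) + 1) := by
    rw [Nat.card_Ico, Nat.cast_sub (hmn k)]
    push_cast
    rw [div_le_iff₀ hn]
    have := Nat.lt_floor_add_one ((a - ε) * ((k : ℝ) + 1))
    have h2 : (1 - (a - ε) + 1 / ((k : ℝ) + 1)) * ((k : ℝ) + 1)
        = ((k : ℝ) + 1) - (a - ε) * ((k : ℝ) + 1) + 1 := by field_simp
    rw [h2]
    linarith
  have hcover : expSeq.real univ ≤ expSeq.real ({e | normalizedSums k e ∈ winnersMem k (Iic a)}
      ∪ exceptional (ε / 4) (m k) k)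
      + expSeq.real {e | ∃ j ∈ Finset.Ico (m k) (k + 1), IsCyclicMax (k + 1) e j} := by
    refine measureReal_le_add_of_ae_imp ?_
    filter_upwards [ae_expSeq_pos] with e he _
    by_cases hx : e ∈ exceptional (ε / 4) (m k) k
    · exact Or.inl (Or.inr hx)
    by_cases hc : e ∈ {e | ∃ j ∈ Finset.Ico (m k) (k + 1), IsCyclicMax (k + 1) e j}
    · exact Or.inr hc
    refine Or.inl (Or.inl fun w hw => ?_)
    have hcm := isCyclicMax_of_notMem_exceptional (fun i _ => he i) hx hw
    have hwm : w.1 < m k := by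
      by_contra h
      exact hc ⟨w, Finset.mem_Ico.2 ⟨not_lt.1 h, by omega⟩, hcm⟩
    simp only [exceptional, mem_union, not_or, sumDeviates, mem_ofPred_eq, not_le] at hx
    have h1 := abs_lt.1 hx.1.2
    have h2 := abs_lt.1 hx.2
    push_cast at h2
    have hT := ((mem_orderedSimplex_normalizedSums_iff e).2 fun i (_ : i ≤ k) => he i).1
    simp only [normalizedSums, mem_Iic]
    rw [div_le_iff₀ hT]
    have h3 := sum_range_mono_of_pos he (show w.1 + 1 ≤ m k from hwm)
    nlinarith [hmle k]
  rw [probReal_univ] at hcover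
  have := measureReal_union_le (μ := expSeq) {e | normalizedSums k e ∈ winnersMem k (Iic a)}
    (exceptional (ε / 4) (m k) k)
  linarith

lemma eventually_le_expSeq_winnersMem_Ioi {a ε : ℝ} (hε : 0 < ε) (hε1 : ε ≤ 1) (h0 : 0 ≤ a)
    (ha : a ≤ 1) : ∀ᶠ k : ℕ in atTop,
    1 - a - 2 * ε < expSeq.real {e | normalizedSums k e ∈ winnersMem k (Ioi a)} := by
  -- As `a + ε` may exceed `1`, `m` may exceed `k + 1`. The partial sum still makes sense because
  -- `e` is an infinite sequence, and the index set below is truncated by `min`.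
  set m : ℕ → ℕ := fun k => ⌈(a + ε) * ((k : ℝ) + 1)⌉₊ with hm
  have hmlt (k : ℕ) : (m k : ℝ) < (a + ε) * ((k : ℝ) + 1) + 1 :=
    Nat.ceil_lt_add_one (by positivity)
  have hmge (k : ℕ) : (a + ε) * ((k : ℝ) + 1) ≤ m k := Nat.le_ceil _
  have hmn (k : ℕ) : m k ≤ 3 * (k + 1) := by
    have h := hmlt k
    have : (m k : ℝ) ≤ ((3 * (k + 1) : ℕ) : ℝ) := by
      push_cast; nlinarith [(k.cast_nonneg : (0 : ℝ) ≤ k)]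
    exact_mod_cast this
  have hbad := tendsto_expSeq_exceptional (δ := ε / 4) (by positivity) (m := m) hmn
  have hlim : Tendsto (fun k : ℕ => (1 - a - ε) - 1 / ((k : ℝ) + 1)
      - expSeq.real (exceptional (ε / 4) (m k) k)) atTop (𝓝 (1 - a - ε - 0 - 0)) :=
    (tendsto_const_nhds.sub tendsto_one_div_add_atTop_nhds_zero_nat).sub hbad
  filter_upwards [hlim.eventually_const_lt (show 1 - a - 2 * ε < 1 - a - ε - 0 - 0 by linarith),
    eventually_ge_atTop 2] with k hk hk2
  refine hk.trans_le ?_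
  have hn : (0 : ℝ) < (k : ℝ) + 1 := by positivity
  have hcyc := expSeq_real_exists_isCyclicMax_le (n := k + 1) (by omega)
    (s := Finset.range (min (m k) (k + 1))) (Finset.range_mono (min_le_right _ _))
  have hcard : ((Finset.range (min (m k) (k + 1))).card : ℝ) / ((k + 1 : ℕ) : ℝ)
      ≤ a + ε + 1 / ((k : ℝ) + 1) := by
    rw [Finset.card_range]
    push_cast
    rw [div_le_iff₀ hn]
    have h2 : (a + ε + 1 / ((k : ℝ) + 1)) * ((k : ℝ) + 1) = (a + ε) * ((k : ℝ) + 1) + 1 := by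
      field_simp
    rw [h2]
    exact (min_le_left _ _).trans (hmlt k).le
  have hcover : expSeq.real univ ≤ expSeq.real ({e | normalizedSums k e ∈ winnersMem k (Ioi a)}
      ∪ exceptional (ε / 4) (m k) k)
      + expSeq.real {e | ∃ j ∈ Finset.range (min (m k) (k + 1)), IsCyclicMax (k + 1) e j} := by
    refine measureReal_le_add_of_ae_imp ?_
    filter_upwards [ae_expSeq_pos] with e he _
    by_cases hx : e ∈ exceptional (ε / 4) (m k) k
    · exact Or.inl (Or.inr hx)
    by_cases hc : e ∈ {e | ∃ j ∈ Finset.range (min (m k) (k + 1)), IsCyclicMax (k + 1) e j}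
    · exact Or.inr hc
    refine Or.inl (Or.inl fun w hw => ?_)
    have hcm := isCyclicMax_of_notMem_exceptional (fun i _ => he i) hx hw
    have hwm : m k ≤ w.1 := by
      by_contra h
      exact hc ⟨w, Finset.mem_range.2 (lt_min (not_le.1 h) (by omega)), hcm⟩
    simp only [exceptional, mem_union, not_or, sumDeviates, mem_ofPred_eq, not_le] at hx
    have h1 := abs_lt.1 hx.1.2
    have h2 := abs_lt.1 hx.2
    push_cast at h2
    have hT := ((mem_orderedSimplex_normalizedSums_iff e).2 fun i (_ : i ≤ k) => he i).1
    simp only [normalizedSums, mem_Ioi]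
    rw [lt_div_iff₀ hT]
    have h3 := sum_range_mono_of_pos he (show m k ≤ w.1 + 1 by omega)
    nlinarith [hmge k]
  rw [probReal_univ] at hcover
  have := measureReal_union_le (μ := expSeq) {e | normalizedSums k e ∈ winnersMem k (Ioi a)}
    (exceptional (ε / 4) (m k) k)
  linarith

/-! ### Transfer to uniform candidates -/

lemma measureReal_mem_eq_pi_unitUniform {Ω : Type*} [MeasurableSpace Ω] {μ : Measure Ω}
    [IsProbabilityMeasure μ] {k : ℕ} {X : Fin k → Ω → ℝ} (hindep : iIndepFun X μ)
    (hunif : ∀ i, HasLaw (X i) unitUniform μ) {B : Set (Fin k → ℝ)} (hB : MeasurableSet B) :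
    μ.real {ω | (fun j => X j ω) ∈ B} = (Measure.pi fun _ : Fin k => unitUniform).real B := by
  have hX (i : Fin k) : AEMeasurable (X i) μ := (hunif i).aemeasurable
  have h := (iIndepFun_iff_map_fun_eq_pi_map hX).1 hindep
  simp_rw [fun i => (hunif i).map_eq] at h
  rw [← h, measureReal_def, measureReal_def, Measure.map_apply_of_aemeasurable
    (aemeasurable_pi_lambda _ hX) hB]
  rfl

lemma pi_unitUniform_real_eq_expSeq {k : ℕ} {B : Set (Fin k → ℝ)} (hB : MeasurableSet B)
    (hsymm : ∀ (σ : Equiv.Perm (Fin k)) x, x ∘ σ ∈ B ↔ x ∈ B) :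
    (Measure.pi fun _ : Fin k => unitUniform).real B = expSeq.real {e | normalizedSums k e ∈ B} := by
  rw [measureReal_def, measureReal_def, expSeq_normalizedSums hB hsymm]

/-- Half-open intervals form a π-system containing small neighbourhoods of every point, and their
masses are differences of distribution functions. Convergence at every point is affordable here
because the uniform distribution function has no jumps. -/
lemma tendsto_probabilityMeasure_of_tendsto_Iic {ν : ℕ → ProbabilityMeasure ℝ}
    {ν₀ : ProbabilityMeasure ℝ}
    (h : ∀ a, Tendsto (fun k => (ν k : Measure ℝ).real (Iic a)) atTop
      (𝓝 ((ν₀ : Measure ℝ).real (Iic a)))) : Tendsto ν atTop (𝓝 ν₀) := by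
  refine (isPiSystem_Ioc (id : ℝ → ℝ) id).tendsto_probabilityMeasure_of_tendsto_of_mem ?_ ?_ ?_
  · rintro _ ⟨a, b, -, rfl⟩
    exact measurableSet_Ioc
  · intro u hu x hx
    obtain ⟨ε, hε, hsub⟩ := Metric.isOpen_iff.1 hu x hx
    refine ⟨_, ⟨x - ε / 2, x + ε / 2, by simp only [id]; linarith, rfl⟩,
      Ioc_mem_nhds (by simp only [id]; linarith) (by simp only [id]; linarith), fun y hy => hsub ?_⟩
    rw [Metric.mem_ball, Real.dist_eq, abs_lt]
    simp only [id, mem_Ioc] at hy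
    constructor <;> linarith [hy.1, hy.2]
  · rintro _ ⟨a, b, hab, rfl⟩
    have hab' : a ≤ b := le_of_lt hab
    have key (ρ : ProbabilityMeasure ℝ) : (ρ : Measure ℝ).real (Ioc a b)
        = (ρ : Measure ℝ).real (Iic b) - (ρ : Measure ℝ).real (Iic a) := by
      rw [← Iic_sdiff_Iic, measureReal_sdiff (Iic_subset_Iic.2 hab') measurableSet_Iic]
    rw [← NNReal.tendsto_coe]
    have := (h b).sub (h a)
    simp_rw [← key] at this
    exact this

lemma unitUniform_real_Iic {a : ℝ} (ha : a ∈ Icc (0 : ℝ) 1) : unitUniform.real (Iic a) = a := by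
  rw [unitUniform, measureReal_restrict_apply measurableSet_Iic]
  have : Iic a ∩ Icc 0 1 = Icc 0 a := by
    ext t; simp only [mem_inter_iff, mem_Iic, mem_Icc]
    exact ⟨fun h => ⟨h.2.1, h.1⟩, fun h => ⟨h.2, h.1, h.2.trans ha.2⟩⟩
  rw [this, Real.volume_real_Icc_of_le ha.1, sub_zero]

theorem mainTheorem3
    {Ω : ℕ → Type*} [∀ k, MeasurableSpace (Ω k)]
    (μ : ∀ k, Measure (Ω k)) [∀ k, IsProbabilityMeasure (μ k)]
    -- `X k i` is the position of candidate `i` in the election with `k` candidates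
    (X : ∀ k, Fin k → Ω k → ℝ)
    (hX_indep : ∀ k, iIndepFun (X k) (μ k))
    (hX_unif : ∀ k i, HasLaw (X k i) unitUniform (μ k))
    -- `P k` is the position of a plurality winner, with ties broken in any way
    (P : ∀ k, Ω k → ℝ)
    (hP_meas : ∀ k, AEMeasurable (P k) (μ k))
    (hP_win : ∀ k, 1 ≤ k → ∀ᵐ ω ∂(μ k),
      ∃ i : Fin k, IsPluralityWinner (fun j => X k j ω) i ∧ P k ω = X k i ω) :
    TendstoInDistribution P atTop (id : ℝ → ℝ) μ unitUniform ∧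
    (∀ x ∈ Icc (0 : ℝ) 1, Tendsto (fun k => (μ k).real {ω | P k ω ≤ x}) atTop (𝓝 x)) ∧
    (∀ x : ℝ, Tendsto
      (fun k : ℕ => (μ k).real {ω | winningShare (fun j => X k j ω) ≤
        (Real.log ((k : ℝ) + 1) + Real.log (Real.log ((k : ℝ) + 1)) + x) / (2 * ((k : ℝ) + 1))})
      atTop (𝓝 (Real.exp (-Real.exp (-x))))) := by
  have hcdf : ∀ x ∈ Icc (0 : ℝ) 1, Tendsto (fun k => (μ k).real {ω | P k ω ≤ x}) atTop (𝓝 x) := by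
    intro a ha
    refine tendsto_order.2 ⟨fun b hb => ?_, fun b hb => ?_⟩
    · rcases ha.1.eq_or_lt with rfl | ha0
      · exact Eventually.of_forall fun _ => hb.trans_le measureReal_nonneg
      -- The second entry gives `b ≤ a - 2 * ε`; the first keeps `ε ≤ a`.
      have hε : 0 < min a ((a - b) / 2) := lt_min ha0 (by linarith)
      filter_upwards [eventually_le_expSeq_winnersMem_Iic hε (min_le_left _ _) ha.2,
        eventually_ge_atTop 1] with k hk hk1
      refine (lt_of_le_of_lt ?_ hk).trans_le ?_
      · linarith [min_le_right a ((a - b) / 2)]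
      -- Constraining all winners at once makes the event symmetric in the candidates and
      -- independent of the tie-breaking rule.
      rw [← pi_unitUniform_real_eq_expSeq (measurableSet_winnersMem measurableSet_Iic)
        winnersMem_comp_perm, ← measureReal_mem_eq_pi_unitUniform (hX_indep k) (hX_unif k)
        (measurableSet_winnersMem measurableSet_Iic)]
      refine measureReal_le_of_ae_imp ?_
      filter_upwards [hP_win k hk1] with ω hω hmem
      obtain ⟨i, hi, hPi⟩ := hω
      exact hPi ▸ hmem i hi
    · have hb' : a < b := hb
      have hε : 0 < min 1 ((b - a) / 2) := lt_min one_pos (by linarith)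
      filter_upwards [eventually_le_expSeq_winnersMem_Ioi hε (min_le_left _ _) ha.1 ha.2,
        eventually_ge_atTop 1] with k hk hk1
      have hms := measurableSet_winnersMem (k := k) (measurableSet_Ioi (a := a))
      have h1 : (μ k).real {ω | P k ω ≤ a}
          ≤ (μ k).real {ω | (fun j => X k j ω) ∈ (winnersMem k (Ioi a))ᶜ} := by
        refine measureReal_le_of_ae_imp ?_
        filter_upwards [hP_win k hk1] with ω hω hle hmem
        obtain ⟨i, hi, hPi⟩ := hω
        exact absurd (hmem i hi) (not_lt.2 (hPi ▸ hle))
      rw [measureReal_mem_eq_pi_unitUniform (hX_indep k) (hX_unif k) hms.compl,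
        probReal_compl_eq_one_sub hms, pi_unitUniform_real_eq_expSeq hms winnersMem_comp_perm] at h1
      linarith [min_le_right 1 ((b - a) / 2)]
  refine ⟨⟨hP_meas, aemeasurable_id, ?_⟩, hcdf, fun x => ?_⟩
  · refine tendsto_probabilityMeasure_of_tendsto_Iic fun a => ?_
    have hmap (k : ℕ) : ((μ k).map (P k)).real (Iic a) = (μ k).real {ω | P k ω ≤ a} := by
      rw [measureReal_def, Measure.map_apply_of_aemeasurable (hP_meas k) measurableSet_Iic]; rfl
    simp only [ProbabilityMeasure.coe_mk, Measure.map_id, hmap]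
    have h0 := hcdf 0 (by simp)
    have h1 := hcdf 1 (by simp)
    -- Outside the unit interval, monotonicity reduces to the limits at `0` and `1`.
    rcases lt_or_ge a 0 with ha0 | ha0
    · have hz : unitUniform.real (Iic a) = 0 :=
        le_antisymm ((measureReal_mono (Iic_subset_Iic.2 ha0.le)).trans_eq
          (unitUniform_real_Iic (by simp))) measureReal_nonneg
      rw [hz]
      exact squeeze_zero (fun _ => measureReal_nonneg)
        (fun k => measureReal_mono fun ω hω => le_trans hω ha0.le) h0
    rcases lt_or_ge 1 a with ha1 | ha1
    · have hz : unitUniform.real (Iic a) = 1 :=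
        le_antisymm measureReal_le_one ((unitUniform_real_Iic (a := 1) (by simp)).symm.trans_le
          (measureReal_mono (Iic_subset_Iic.2 ha1.le)))
      rw [hz]
      exact tendsto_of_tendsto_of_tendsto_of_le_of_le h1 tendsto_const_nhds
        (fun k => measureReal_mono fun ω hω => le_trans hω ha1.le) fun k => measureReal_le_one
    · rw [unitUniform_real_Iic ⟨ha0, ha1⟩]
      exact hcdf a ⟨ha0, ha1⟩
  · refine (tendsto_expSeq_winningShare x).congr fun k => ?_
    have hms : MeasurableSet {y : Fin k → ℝ | winningShare y ≤ gumbelLevel x k / (2 * ((k : ℝ) + 1))} :=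
      measurableSet_le measurable_winningShare measurable_const
    exact (pi_unitUniform_real_eq_expSeq hms fun σ y => by
      simp only [mem_ofPred_eq, winningShare_comp_perm]).symm.trans
      (measureReal_mem_eq_pi_unitUniform (hX_indep k) (hX_unif k) hms).symm
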